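/- **Setting.** Let $f$ be an increasing real function on $[0,1]$, let $d_0\in(0,1)$, and put $\theta_0=f(d_0)$. Let $p\in(0,1)$, $K>0$ and $\gamma>0$ be fixed. *Design and errors.* Let $\{x_{im}\}_{i=1}^m$, $m\ge 1$, be a triangular array of distinct, increasing design points in $[0,1]$ with empirical distribution functions $F_m$. Let $\varepsilon$ be a continuous random variable with mean $0$ and variance $\sigma^2>0$. On a probability space $(\Omega,\mathscr A,P)$ let there be given random errors $\varepsilon_{in},\varepsilon'_{in},\varepsilon''_{in}$ ($1\le i\le n$, $n\ge1$) such that for each $n$ the $3n$ errors of row $n$ are i.i.d. copies of $\varepsilon$ (no assumption is made on the dependence between different rows). *Two-stage estimator.* For a total budget $n$ let $n_1$ be $\lfloor np\rfloor$ if $n-\lfloor np\rfloor$ is even and $\lfloor np\rfloor+1$ otherwise, and let $n_2=(n-n_1)/2$. In the first stage observe $Y_i=f(x_{in_1})+\varepsilon_{in}$, $1\le i\le n_1$. Let $\hat f$ be the isotonic least squares regression of these data, extended from the design points to a right-continuous step function, and let $\hat d=\hat d^{(1)}_{n_1}=\inf\{t\in[0,1]:\hat f(t)\ge\theta_0\}$.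 Put $L=\hat d-Kn_1^{-\gamma}$ and $U=\hat d+Kn_1^{-\gamma}$. In the second stage observe $Y'_i=f(L)+\varepsilon'_{in}$ and $Y''_i=f(U)+\varepsilon''_{in}$, $1\le i\le n_2$. (If $L$ or $U$ lies outside $[0,1]$, the values of $f$ there are arbitrary.) Let $(\hat\beta_0,\hat\beta_1)$ be the intercept and slope of the least squares line through the data $(L,Y'_i),(U,Y''_i)$, and let $\tilde d^{(2)}_n=(\theta_0-\hat\beta_0)/\hat\beta_1$. *Bootstrap.* Given the data, draw $Y'^\star_1,\dots,Y'^\star_{n_2}$ and, independently, $Y''^\star_1,\dots,Y''^\star_{n_2}$ uniformly with replacement from $Y'_1,\dots,Y'_{n_2}$ and $Y''_1,\dots,Y''_{n_2}$, respectively. Let $(\hat\beta^\star_0,\hat\beta_1^\star)$ be the coefficients of the least squares line through $(L,Y'^\star_i),(U,Y''^\star_i)$, and let $\tilde d^{(2)\star}_n=(\theta_0-\hat\beta^\star_0)/\hat\beta^\star_1$. Write $P^\star$ for the conditional probability given the data. (A quotient with denominator $0$ is given the value $0$.) **Theorem.** Assume that $\gamma\in(0,1/3)$ and that: - ($f\in\mathscr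 F$) in a neighbourhood of $d_0$, $f$ has a positive and continuous first derivative and a uniformly bounded third derivative; - (A2) there is a distribution function $G$ whose Lebesgue density $g$ is positive and has a bounded first derivative on $[0,1]$, and a constant $c$ such that $\sup_{t\in[0,1]}|F_m(t)-G(t)|\le c\,m^{-1/2}$ for all $m\ge1$; - (A3) $f$ is differentiable on $[0,1]$, with $\inf_{[0,1]}f'>0$ and $\sup_{[0,1]}f'<\infty$; - (A4) $\mathbb E|\varepsilon|^q<\infty$ for all $q\in\mathbb N$. Let $C_2=\sigma/[f'(d_0)(1-p)^{1/2}]$ and let $Z_1$ be standard normal. Then, for $P$-almost every $\omega\in\Omega$, the conditional law under $P^\star$ of $n^{1/2}\bigl(\tilde d^{(2)\star}_n-\tilde d^{(2)}_n\bigr)$ converges weakly to the law of $C_2Z_1$ as $n\to\infty$, and $$\sup_{t\in\mathbb R}\Bigl|P^\star\bigl(n^{1/2}(\tilde d_n^{(2)\star}-\tilde d_n^{(2)})\le t\bigr)-P(C_2Z_1\le t)\Bigr|\longrightarrow 0 .$$ -/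

import Mathlib

open MeasureTheory ProbabilityTheory Filter Topology Set

noncomputable section

namespace TwoStage

/-! ## The regression function -/

/-- `f` is increasing on `[0,1]` and has a positive and continuous first derivative in a
neighbourhood of `d₀`. -/
structure InClassFZero (f : ℝ → ℝ) (d₀ : ℝ) : Prop where
  monotoneOn : MonotoneOn f (Icc 0 1)
  smooth_near : ∃ δ > 0,
    (∀ x ∈ Ioo (d₀ - δ) (d₀ + δ), DifferentiableAt ℝ f x ∧ 0 < deriv f x) ∧
    ContinuousOn (deriv f) (Ioo (d₀ - δ) (d₀ + δ))

/-- `f` is in the previous class, and its third derivative exists and is uniformly bounded in a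
neighbourhood of `d₀`. -/
structure InClassF (f : ℝ → ℝ) (d₀ : ℝ) : Prop extends InClassFZero f d₀ where
  third_deriv_bounded : ∃ δ > 0, ∃ M : ℝ, ∀ x ∈ Ioo (d₀ - δ) (d₀ + δ),
    DifferentiableAt ℝ f x ∧ DifferentiableAt ℝ (iteratedDeriv 1 f) x ∧
    DifferentiableAt ℝ (iteratedDeriv 2 f) x ∧ |iteratedDeriv 3 f x| ≤ M

/-- `f` is differentiable on `[0,1]` (one-sidedly at the end points), and its derivative is bounded
above and bounded away from zero there. -/
def HasBoundedSlope (f : ℝ → ℝ) : Prop :=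
  DifferentiableOn ℝ f (Icc 0 1) ∧
  ∃ a b : ℝ, 0 < a ∧ ∀ x ∈ Icc (0 : ℝ) 1,
    a ≤ derivWithin f (Icc 0 1) x ∧ derivWithin f (Icc 0 1) x ≤ b

/-! ## The design -/

/-- The empirical distribution function of the points `x 0, …, x (m - 1)`. -/
def empiricalCDF {m : ℕ} (x : Fin m → ℝ) (t : ℝ) : ℝ :=
  ((Finset.univ.filter fun i => x i ≤ t).card : ℝ) / m

/-- A triangular array (`x m` is the row of length `m`) of increasing, distinct design points of
`[0,1]`. -/
def IsDesignArray (x : (m : ℕ) → Fin m → ℝ) : Prop :=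
  ∀ m, StrictMono (x m) ∧ ∀ i, x m i ∈ Icc (0 : ℝ) 1

/-- There is a distribution function `G` (the one of the probability measure `ν`) whose Lebesgue
density `g` is positive and has a bounded first derivative on `[0,1]`, such that
`sup_{t ∈ [0,1]} |F_m t - G t| ≤ C m ^ (-1/2)` for the empirical distribution functions `F_m`
of the rows. -/
def IsRegularDesign (x : (m : ℕ) → Fin m → ℝ) : Prop :=
  ∃ (ν : Measure ℝ) (g : ℝ → ℝ), IsProbabilityMeasure ν ∧ Measurable g ∧ (∀ t, 0 ≤ g t) ∧
    ν = volume.withDensity (fun t => ENNReal.ofReal (g t)) ∧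
    (∀ t ∈ Icc (0 : ℝ) 1, 0 < g t) ∧
    DifferentiableOn ℝ g (Icc 0 1) ∧
    (∃ B : ℝ, ∀ t ∈ Icc (0 : ℝ) 1, |derivWithin g (Icc 0 1) t| ≤ B) ∧
    ∃ C : ℝ, ∀ m : ℕ, 0 < m → ∀ t ∈ Icc (0 : ℝ) 1,
      |empiricalCDF (x m) t - cdf ν t| ≤ C / Real.sqrt m

/-! ## The errors -/

/-- `μ` is the law of the generic error: a continuous law with mean `0` and variance
`σ ^ 2 > 0`. -/
structure IsErrorLaw (μ : Measure ℝ) (σ : ℝ) : Prop where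
  isProbabilityMeasure : IsProbabilityMeasure μ
  noAtoms : NullSingletonClass μ
  pos : 0 < σ
  integrable_sq : Integrable (fun z : ℝ => z ^ 2) μ
  mean_eq : ∫ z, z ∂μ = 0
  var_eq : ∫ z, z ^ 2 ∂μ = σ ^ 2

/-- All absolute moments of `μ` are finite. -/
def HasAllMoments (μ : Measure ℝ) : Prop :=
  ∀ q : ℕ, Integrable (fun z : ℝ => |z| ^ q) μ

/-- For every `n`, the `3 n` random variables `ε n i`, `ε' n i`, `ε'' n i`, `i < n`, are
independent copies of a random variable with law `μ`. Nothing is assumed about the dependence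
between different rows. -/
structure IsErrorArray {Ω : Type*} [MeasurableSpace Ω] (P : Measure Ω) (μ : Measure ℝ)
    (ε ε' ε'' : ℕ → ℕ → Ω → ℝ) : Prop where
  law : ∀ n, ∀ i < n, HasLaw (ε n i) μ P ∧ HasLaw (ε' n i) μ P ∧ HasLaw (ε'' n i) μ P
  indep : ∀ n, iIndepFun (fun j : Fin 3 × Fin n =>
    (![ε n, ε' n, ε'' n] j.1 : ℕ → Ω → ℝ) j.2) P

/-! ## Isotonic regression and the first-stage estimator -/

/-- `v` is an isotonic least squares fit of the responses `y` (listed in the order of the design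
points). -/
def IsIsotonicFit {m : ℕ} (y v : Fin m → ℝ) : Prop :=
  Monotone v ∧ ∀ u : Fin m → ℝ, Monotone u → ∑ i, (y i - v i) ^ 2 ≤ ∑ i, (y i - u i) ^ 2

theorem exists_isIsotonicFit {m : ℕ} (y : Fin m → ℝ) : ∃ v, IsIsotonicFit y v := by
  let S : Set (EuclideanSpace ℝ (Fin m)) := {v | ∀ i j : Fin m, i ≤ j → v i ≤ v j}
  have hne : S.Nonempty := ⟨0, fun i j _ => le_refl _⟩
  have hcl : IsClosed S := by
    have : S = ⋂ i, ⋂ j, ⋂ _ : i ≤ j, {v : EuclideanSpace ℝ (Fin m) | v i ≤ v j} := by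
      ext v; simp [S]
    rw [this]
    refine isClosed_iInter fun i => isClosed_iInter fun j => isClosed_iInter fun _ => ?_
    exact isClosed_le (by fun_prop) (by fun_prop)
  have hcv : Convex ℝ S := by
    intro v hv w hw a b ha hb _ i j hij
    have h1 := mul_le_mul_of_nonneg_left (hv i j hij) ha
    have h2 := mul_le_mul_of_nonneg_left (hw i j hij) hb
    simpa using add_le_add h1 h2
  obtain ⟨v, hv, hmin⟩ := exists_norm_eq_iInf_of_complete_convex hne hcl.isComplete hcv
    (WithLp.toLp 2 y)
  refine ⟨fun i => v i, fun i j hij => hv i j hij, fun u hu => ?_⟩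
  have hle : ‖WithLp.toLp 2 y - v‖ ≤ ‖WithLp.toLp 2 y - WithLp.toLp 2 u‖ := by
    rw [hmin]
    exact ciInf_le (f := fun w : S => ‖WithLp.toLp 2 y - (w : EuclideanSpace ℝ (Fin m))‖)
      ⟨0, by rintro _ ⟨w, rfl⟩; exact norm_nonneg _⟩ ⟨WithLp.toLp 2 u, fun i j hij => hu hij⟩
  have hsq := pow_le_pow_left₀ (norm_nonneg _) hle 2
  simpa [EuclideanSpace.norm_sq_eq] using hsq

/-- The fitted values of the isotonic regression of `y` (they are unique). -/
def isotonicFit {m : ℕ} (y : Fin m → ℝ) : Fin m → ℝ := (exists_isIsotonicFit y).choose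

/-- The isotonic regression estimate of the regression function: the right-continuous step
function, with jumps only at design points, that takes the isotonic fitted values at the design
points. (To the left of the first design point, it keeps the smallest fitted value.) -/
def isotonicRegression {m : ℕ} (x y : Fin m → ℝ) (t : ℝ) : ℝ :=
  open Classical in
  if ∃ i, x i ≤ t then ⨆ i : {i // x i ≤ t}, isotonicFit y i else ⨅ i, isotonicFit y i

/-- `inf {t ∈ [0,1] : g t ≥ θ}`; the infimum is taken in `[0,1]`, so that it is `1` when the set is
empty. -/
def levelInverse (g : ℝ → ℝ) (θ : ℝ) : ℝ :=
  sInf (insert 1 {t : ℝ | t ∈ Icc (0 : ℝ) 1 ∧ θ ≤ g t})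

/-! ## The two-stage estimator -/

/-- The first-stage sample size for a total budget `n`: `⌊n p⌋` or `⌊n p⌋ + 1`, whichever leaves an
even number of observations. -/
def firstSize (p : ℝ) (n : ℕ) : ℕ :=
  if Even (n - ⌊(n : ℝ) * p⌋₊) then ⌊(n : ℝ) * p⌋₊ else ⌊(n : ℝ) * p⌋₊ + 1

/-- The number `n₂` of second-stage observations at each of the two points. -/
def secondSize (p : ℝ) (n : ℕ) : ℕ := (n - firstSize p n) / 2

/-- The first-stage estimator of `d₀` for a total budget `n`, from the responses
`f (x i) + e i` at the design points of row `n₁`. Here `e` lists the first-stage errors. -/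
def firstEstimate (f : ℝ → ℝ) (d₀ p : ℝ) (x : (m : ℕ) → Fin m → ℝ) (n : ℕ) (e : ℕ → ℝ) : ℝ :=
  levelInverse
    (isotonicRegression (x (firstSize p n)) fun i => f (x (firstSize p n) i) + e i) (f d₀)

/-- The lower second-stage sampling point. -/
def lowerPoint (f : ℝ → ℝ) (d₀ p K γ : ℝ) (x : (m : ℕ) → Fin m → ℝ) (n : ℕ) (e : ℕ → ℝ) : ℝ :=
  firstEstimate f d₀ p x n e - K * (firstSize p n : ℝ) ^ (-γ)

/-- The upper second-stage sampling point. -/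
def upperPoint (f : ℝ → ℝ) (d₀ p K γ : ℝ) (x : (m : ℕ) → Fin m → ℝ) (n : ℕ) (e : ℕ → ℝ) : ℝ :=
  firstEstimate f d₀ p x n e + K * (firstSize p n : ℝ) ^ (-γ)

/-- The average of `k` numbers. -/
def mean {k : ℕ} (y : Fin k → ℝ) : ℝ := (∑ i, y i) / k

/-- Slope of the least squares line through the data `(L, y i)`, `(U, z i)`, `i < k`. -/
def lsSlope {k : ℕ} (L U : ℝ) (y z : Fin k → ℝ) : ℝ := (mean z - mean y) / (U - L)

/-- Intercept of the least squares line through the data `(L, y i)`, `(U, z i)`, `i < k`. -/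
def lsIntercept {k : ℕ} (L U : ℝ) (y z : Fin k → ℝ) : ℝ :=
  (mean y + mean z) / 2 - (L + U) / 2 * lsSlope L U y z

/-- The two formulas above do give the least squares line. -/
theorem ls_le {k : ℕ} (hk : 0 < k) {L U : ℝ} (h : L ≠ U) (y z : Fin k → ℝ) (b₀ b₁ : ℝ) :
    ∑ i, ((y i - lsIntercept L U y z - lsSlope L U y z * L) ^ 2 +
        (z i - lsIntercept L U y z - lsSlope L U y z * U) ^ 2) ≤
      ∑ i, ((y i - b₀ - b₁ * L) ^ 2 + (z i - b₀ - b₁ * U) ^ 2) := by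
  have hne : U - L ≠ 0 := sub_ne_zero.mpr h.symm
  have hL : lsIntercept L U y z + lsSlope L U y z * L = mean y := by
    unfold lsIntercept lsSlope; field_simp; ring
  have hU : lsIntercept L U y z + lsSlope L U y z * U = mean z := by
    unfold lsIntercept lsSlope; field_simp; ring
  have key : ∀ (w : Fin k → ℝ) (c : ℝ), ∑ i, (w i - mean w) ^ 2 ≤ ∑ i, (w i - c) ^ 2 := by
    intro w c
    have hk' : (k : ℝ) ≠ 0 := by positivity
    have hs : ∑ i, w i = k * mean w := by unfold mean; field_simp
    have e1 : ∀ a : ℝ, ∑ i, (w i - a) ^ 2 = ∑ i, w i ^ 2 - 2 * a * (k * mean w) + k * a ^ 2 := by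
      intro a
      rw [← hs, Finset.mul_sum, ← Finset.sum_sub_distrib]
      have : (k : ℝ) * a ^ 2 = ∑ _i : Fin k, a ^ 2 := by simp
      rw [this, ← Finset.sum_add_distrib]
      exact Finset.sum_congr rfl fun i _ => by ring
    rw [e1, e1]
    nlinarith [mul_nonneg (Nat.cast_nonneg (α := ℝ) k) (sq_nonneg (mean w - c))]
  simp only [sub_sub, hL, hU, Finset.sum_add_distrib]
  exact add_le_add (key y _) (key z _)

/-- The abscissa at which the least squares line reaches the level `θ`. -/
def lsInverse {k : ℕ} (θ L U : ℝ) (y z : Fin k → ℝ) : ℝ :=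
  (θ - lsIntercept L U y z) / lsSlope L U y z

/-- The second-stage responses at `L`; `e` and `e'` list the first-stage errors and the errors
at `L`. -/
def lowerResponse (f : ℝ → ℝ) (d₀ p K γ : ℝ) (x : (m : ℕ) → Fin m → ℝ) (n : ℕ) (e e' : ℕ → ℝ)
    (i : Fin (secondSize p n)) : ℝ :=
  f (lowerPoint f d₀ p K γ x n e) + e' i

/-- The second-stage responses at `U`; `e` and `e''` list the first-stage errors and the errors
at `U`. -/
def upperResponse (f : ℝ → ℝ) (d₀ p K γ : ℝ) (x : (m : ℕ) → Fin m → ℝ) (n : ℕ) (e e'' : ℕ → ℝ)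
    (i : Fin (secondSize p n)) : ℝ :=
  f (upperPoint f d₀ p K γ x n e) + e'' i

/-- The two-stage estimator of `d₀`. -/
def twoStageEstimate (f : ℝ → ℝ) (d₀ p K γ : ℝ) (x : (m : ℕ) → Fin m → ℝ) (n : ℕ)
    (e e' e'' : ℕ → ℝ) : ℝ :=
  lsInverse (f d₀) (lowerPoint f d₀ p K γ x n e) (upperPoint f d₀ p K γ x n e)
    (lowerResponse f d₀ p K γ x n e e') (upperResponse f d₀ p K γ x n e e'')

/-! ## The bootstrap -/

/-- The outcomes of the resampling step: `r (0, i)` and `r (1, i)` are the indices of the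
observations at `L` and at `U` that are drawn as the `i`-th bootstrap responses. -/
abbrev Resample (k : ℕ) : Type := Fin 2 × Fin k → Fin k

/-- The law of the resampling step, sampling with replacement: all indices are drawn independently
and uniformly. -/
def bootstrapMeasure (k : ℕ) : Measure (Resample k) :=
  Measure.pi fun _ => uniformOn (univ : Set (Fin k))

instance bootstrapMeasure_isProbabilityMeasure (k : ℕ) : IsProbabilityMeasure (bootstrapMeasure k) := by
  unfold bootstrapMeasure
  rcases Nat.eq_zero_or_pos k with rfl | hk
  · rw [Measure.pi_of_empty]
    infer_instance
  · have : Nonempty (Fin k) := ⟨⟨0, hk⟩⟩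
    have : IsProbabilityMeasure (uniformOn (univ : Set (Fin k))) :=
      isProbabilityMeasure_uniformOn finite_univ univ_nonempty
    infer_instance

/-- The bootstrapped two-stage estimator: the two-stage estimator (with the same `L` and `U`)
recomputed from the resampled second-stage responses. -/
def bootstrapEstimate (f : ℝ → ℝ) (d₀ p K γ : ℝ) (x : (m : ℕ) → Fin m → ℝ) (n : ℕ)
    (e e' e'' : ℕ → ℝ) (r : Resample (secondSize p n)) : ℝ :=
  lsInverse (f d₀) (lowerPoint f d₀ p K γ x n e) (upperPoint f d₀ p K γ x n e)
    (fun i => lowerResponse f d₀ p K γ x n e e' (r (0, i)))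
    (fun i => upperResponse f d₀ p K γ x n e e'' (r (1, i)))

/-- The bootstrapped root `√n (bootstrapped two-stage estimator - two-stage estimator)`. -/
def bootstrapRoot (f : ℝ → ℝ) (d₀ p K γ : ℝ) (x : (m : ℕ) → Fin m → ℝ) (n : ℕ)
    (e e' e'' : ℕ → ℝ) (r : Resample (secondSize p n)) : ℝ :=
  Real.sqrt n *
    (bootstrapEstimate f d₀ p K γ x n e e' e'' r - twoStageEstimate f d₀ p K γ x n e e' e'')

/-- The constant `σ / (f'(d₀) (1 - p) ^ (1/2))`. -/
def limitScale (f : ℝ → ℝ) (d₀ p σ : ℝ) : ℝ := σ / (deriv f d₀ * Real.sqrt (1 - p))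

end TwoStage

end

/-! The randomness of the data enters only through a few almost sure limits; given these, the
bootstrap is analysed for fixed data. Write δ = K n₁^(-γ), k = n₂, b = f'(d₀), θ₀ = f(d₀).

For fixed data, suppose that the first-stage error and the averages of the second-stage errors at L
and U are o(n^(-γ)), hence o(δ), that the mean squares of these errors tend to σ², and that their
mean absolute cubes converge. Then f(L) and f(U) are θ₀ ∓ bδ + o(δ). So the fitted slope tends to b,
and W, the difference between θ₀ and the height of the fitted line at the midpoint, is o(δ).
Resampling shifts the two response means by A and B, of order n^(-1/2), and the slope by (B -
A)/(2δ), which is small because √n δ → ∞. The changed slope alters the root by about √n W (B -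
A)/(2δ b²) = o(1), so the root is -√n (A + B)/(2b) + o(1) in conditional probability
(`abs_root_sub_linear_le`, `eventually_bootstrapRoot_close`). This linear part is a sum of 2k
independent centred draws with bounded third moments; its variance nσ²/(2b²k) tends to C₂² and its
characteristic function to the Gaussian one (`tendsto_integral_exp_bootstrap`). Pólya's theorem
makes the convergence of distribution functions uniform.

The almost sure limits rest on `ae_eventually_partial_sums_lt`: high moments, a union bound over at
most n + 1 sums per row, and the first Borel–Cantelli lemma, which requires nothing about the
dependence between rows. For the first stage, if the estimator misses d₀ by more than h = η n^(-γ),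
optimality of the isotonic fit produces a block of at least order n h design points on which the
errors average at least a h/2 in absolute value, a being a lower bound of f'. Such blocks are
described by one index, so there are few of them. The squared threshold exceeds the variance by a
factor of order n h³, that is n^(1 - 3γ), which is where γ < 1/3 is needed. -/

namespace TwoStage

/-! ## Moments of sums of independent centered random variables -/

/-- `X` is a family of independent, centered random variables whose absolute moments are finite,
the one of order `r` being bounded by `A r`. -/
structure IsCenteredFamily {Ω : Type*} [MeasurableSpace Ω] (P : Measure Ω) (A : ℕ → ℝ)
    {ι : Type*} (X : ι → Ω → ℝ) : Prop where
  indep : iIndepFun X P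
  aemeasurable : ∀ i, AEMeasurable (X i) P
  integrable_pow : ∀ i r, Integrable (fun ω => |X i ω| ^ r) P
  mean_eq : ∀ i, ∫ ω, X i ω ∂P = 0
  moment_le : ∀ i r, ∫ ω, |X i ω| ^ r ∂P ≤ A r

section Moments

variable {Ω : Type*} [MeasurableSpace Ω] {P : Measure Ω} {A : ℕ → ℝ}
  {ι : Type*} {X : ι → Ω → ℝ}

theorem memLp_nat_of_integrable_pow {Y : Ω → ℝ} (hY : AEMeasurable Y P) (r : ℕ)
    (h : Integrable (fun ω => |Y ω| ^ r) P) : MemLp Y r P := by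
  rcases Nat.eq_zero_or_pos r with rfl | hr
  · simpa using hY.aestronglyMeasurable
  · refine (integrable_norm_rpow_iff hY.aestronglyMeasurable (by exact_mod_cast hr.ne')
      (by simp)).1 ?_
    simpa using h

theorem IsCenteredFamily.abs_integral_pow_le (h : IsCenteredFamily P A X) (a : ι) (j : ℕ) :
    |∫ ω, X a ω ^ j ∂P| ≤ A j := by
  refine (abs_integral_le_integral_abs).trans ?_
  simpa using h.moment_le a j

variable [IsProbabilityMeasure P]

theorem IsCenteredFamily.integrable_sum_pow (h : IsCenteredFamily P A X) (s : Finset ι) (r : ℕ) :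
    Integrable (fun ω => (∑ i ∈ s, X i ω) ^ r) P := by
  have h1 : MemLp (fun ω => ∑ i ∈ s, X i ω) r P :=
    memLp_finsetSum s fun i _ =>
      memLp_nat_of_integrable_pow (h.aemeasurable i) r (h.integrable_pow i r)
  have h2 := h1.integrable_norm_pow'
  refine h2.mono' (h1.1.pow r) (ae_of_all _ fun ω => ?_)
  simp

theorem IsCenteredFamily.integral_sum_insert_pow [DecidableEq ι] (h : IsCenteredFamily P A X)
    {s : Finset ι} {a : ι} (ha : a ∉ s) (r : ℕ) :
    ∫ ω, (∑ i ∈ insert a s, X i ω) ^ r ∂P =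
      ∑ j ∈ Finset.range (r + 1),
        (∫ ω, X a ω ^ j ∂P) * (∫ ω, (∑ i ∈ s, X i ω) ^ (r - j) ∂P) * (r.choose j) := by
  have hind : IndepFun (∑ j ∈ s, X j) (X a) P :=
    h.indep.indepFun_finsetSum_of_notMem₀ h.aemeasurable ha
  have hind' : ∀ j, IndepFun (fun ω => X a ω ^ j) (fun ω => (∑ i ∈ s, X i ω) ^ (r - j)) P := by
    intro j
    have := (hind.symm).comp (φ := fun x : ℝ => x ^ j) (ψ := fun x : ℝ => x ^ (r - j))
      (by fun_prop) (by fun_prop)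
    convert this using 1 <;> (ext ω; simp)
  have hXint : ∀ j, Integrable (fun ω => X a ω ^ j) P := fun j => by
    simpa using h.integrable_sum_pow {a} j
  have hint : ∀ j, Integrable
      (fun ω => X a ω ^ j * (∑ i ∈ s, X i ω) ^ (r - j) * (r.choose j : ℝ)) P := fun j =>
    ((hind' j).integrable_mul (hXint j) (h.integrable_sum_pow s _)).mul_const _
  simp only [Finset.sum_insert ha, add_pow]
  rw [integral_finsetSum _ fun j _ => hint j]
  refine Finset.sum_congr rfl fun j _ => ?_
  rw [integral_mul_const, (hind' j).integral_fun_mul_eq_mul_integral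
    (hXint j).aestronglyMeasurable (h.integrable_sum_pow s _).aestronglyMeasurable]

/-- The moment of order `r` of a sum of `N` independent centered random variables is
`O(N ^ (r / 2))`. -/
theorem exists_moment_bound (P : Measure Ω) [IsProbabilityMeasure P] (A : ℕ → ℝ) (r : ℕ) :
    ∃ C : ℝ, 0 ≤ C ∧ ∀ (ι : Type) (X : ι → Ω → ℝ), IsCenteredFamily P A X →
      ∀ s : Finset ι, |∫ ω, (∑ i ∈ s, X i ω) ^ r ∂P| ≤ C * (s.card : ℝ) ^ (r / 2) := by
  induction r using Nat.strong_induction_on with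
  | _ r ih =>
  have ih' : ∀ q, ∃ C : ℝ, 0 ≤ C ∧ (q < r → ∀ (ι : Type) (X : ι → Ω → ℝ), IsCenteredFamily P A X →
      ∀ s : Finset ι, |∫ ω, (∑ i ∈ s, X i ω) ^ q ∂P| ≤ C * (s.card : ℝ) ^ (q / 2)) := by
    intro q
    by_cases hq : q < r
    · obtain ⟨C, h0, hC⟩ := ih q hq
      exact ⟨C, h0, fun _ => hC⟩
    · exact ⟨0, le_rfl, fun h => absurd h hq⟩
  choose C hC0 hC using ih'
  rcases Nat.lt_or_ge r 2 with hr | hr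
  · interval_cases r
    · exact ⟨1, zero_le_one, fun ι X _ s => by simp⟩
    · refine ⟨1, zero_le_one, fun ι X h s => ?_⟩
      have : ∫ ω, ∑ i ∈ s, X i ω ∂P = 0 := by
        rw [integral_finsetSum]
        · exact Finset.sum_eq_zero fun i _ => h.mean_eq i
        · intro i _
          simpa using h.integrable_sum_pow {i} 1
      simp [this]
  -- In the binomial expansion of (X_a + S)^r, the term j = 0 is the moment of the shorter sum and j
  -- = 1 vanishes by centring. `D` bounds the coefficients of the terms j ≥ 2, whose lower moments
  -- of S are known by induction on r.
  set D : ℝ := ∑ j ∈ Finset.Ico 2 (r + 1), |A j| * C (r - j) * r.choose j with hD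
  have hD0 : 0 ≤ D := Finset.sum_nonneg fun j _ => by have := hC0 (r - j); positivity
  refine ⟨D, hD0, fun ι X h s => ?_⟩
  classical
  induction s using Finset.induction_on with
  | empty =>
    have : r ≠ 0 := by omega
    simp only [Finset.sum_empty, zero_pow this]
    simp only [integral_zero, abs_zero, Finset.card_empty, Nat.cast_zero]
    positivity
  | insert a s ha ihs =>
    rw [h.integral_sum_insert_pow ha, ← Finset.sum_range_add_sum_Ico _ (show 2 ≤ r + 1 by omega)]
    have e1 : ∫ ω, X a ω ∂P = 0 := h.mean_eq a
    simp only [Finset.sum_range_succ, Finset.sum_range_zero, pow_zero, pow_one, e1]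
    rw [Finset.card_insert_of_notMem ha]
    simp only [integral_const, probReal_univ, smul_eq_mul, one_mul, mul_one, Nat.sub_zero,
      Nat.choose_zero_right, Nat.cast_one, zero_mul, add_zero, zero_add, Nat.cast_add]
    have hN1 : (1 : ℝ) ≤ (s.card : ℝ) + 1 := by have := Nat.cast_nonneg (α := ℝ) s.card; linarith
    have hrest : |∑ j ∈ Finset.Ico 2 (r + 1), (∫ ω, X a ω ^ j ∂P) *
        (∫ ω, (∑ i ∈ s, X i ω) ^ (r - j) ∂P) * (r.choose j)| ≤
        D * ((s.card : ℝ) + 1) ^ (r / 2 - 1) := by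
      rw [hD, Finset.sum_mul]
      refine (Finset.abs_sum_le_sum_abs _ _).trans (Finset.sum_le_sum fun j hj => ?_)
      rw [Finset.mem_Ico] at hj
      rw [abs_mul, abs_mul, Nat.abs_cast]
      have h1 : |∫ ω, X a ω ^ j ∂P| ≤ |A j| := (h.abs_integral_pow_le a j).trans (le_abs_self _)
      have h2 := hC (r - j) (by omega) ι X h s
      -- Since j ≥ 2, each of these terms gains a full power of the cardinality.
      have h3 : (s.card : ℝ) ^ ((r - j) / 2) ≤ ((s.card : ℝ) + 1) ^ (r / 2 - 1) :=
        (pow_le_pow_left₀ (by positivity) (by linarith) _).trans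
          (pow_le_pow_right₀ hN1 (by omega))
      have h4 := h2.trans (mul_le_mul_of_nonneg_left h3 (hC0 _))
      calc |∫ ω, X a ω ^ j ∂P| * |∫ ω, (∑ i ∈ s, X i ω) ^ (r - j) ∂P| * (r.choose j : ℝ)
          ≤ |A j| * (C (r - j) * ((s.card : ℝ) + 1) ^ (r / 2 - 1)) * (r.choose j : ℝ) := by gcongr
        _ = _ := by ring
    obtain ⟨q, hq⟩ : ∃ q, r / 2 = q + 1 := ⟨r / 2 - 1, by omega⟩
    rw [hq] at ihs hrest ⊢
    simp only [Nat.add_sub_cancel] at hrest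
    refine (abs_add_le _ _).trans ((add_le_add ihs hrest).trans ?_)
    rw [← mul_add]
    refine mul_le_mul_of_nonneg_left ?_ hD0
    have : (s.card : ℝ) ^ q ≤ ((s.card : ℝ) + 1) ^ q :=
      pow_le_pow_left₀ (by positivity) (by linarith) _
    -- What remains is N^(q+1) + (N+1)^q ≤ (N+1)^(q+1).
    rw [pow_succ, pow_succ]
    nlinarith [Nat.cast_nonneg (α := ℝ) s.card]

/-- Markov's inequality for the moment of order 2q. The constant depends only on the moment bounds,
so it serves all rows of the array at once; `a` measures by how much the squared threshold exceeds
the number of summands. -/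
theorem exists_tail_bound (P : Measure Ω) [IsProbabilityMeasure P] (A : ℕ → ℝ) (q : ℕ) :
    ∃ C : ℝ, 0 ≤ C ∧ ∀ (ι : Type) (X : ι → Ω → ℝ), IsCenteredFamily P A X →
      ∀ (s : Finset ι) (τ a : ℝ), 0 < τ → 0 < a → s.card * a ≤ τ ^ 2 →
        P.real {ω | τ ≤ |∑ i ∈ s, X i ω|} ≤ C / a ^ q := by
  obtain ⟨C, hC0, hC⟩ := exists_moment_bound P A (2 * q)
  refine ⟨C, hC0, fun ι X h s τ a hτ ha hs => ?_⟩
  have h1 := mul_meas_ge_le_integral_of_nonneg (μ := P)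
    (f := fun ω => (∑ i ∈ s, X i ω) ^ (2 * q))
    (ae_of_all _ fun ω => by simp only [Pi.zero_apply, pow_mul]; positivity)
    (h.integrable_sum_pow s _) (τ ^ (2 * q))
  have h2 := hC ι X h s
  rw [Nat.mul_div_cancel_left q two_pos] at h2
  have h3 : P.real {ω | τ ≤ |∑ i ∈ s, X i ω|} ≤
      P.real {ω | τ ^ (2 * q) ≤ (∑ i ∈ s, X i ω) ^ (2 * q)} := by
    refine measureReal_mono (fun ω hω => ?_)
    simp only [mem_ofPred_eq] at hω ⊢
    rw [← (even_two_mul q).pow_abs (∑ i ∈ s, X i ω)]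
    exact pow_le_pow_left₀ hτ.le hω _
  have h4 : ((s.card : ℝ) * a) ^ q ≤ τ ^ (2 * q) := by
    rw [pow_mul]; exact pow_le_pow_left₀ (by positivity) hs _
  have h5 : τ ^ (2 * q) * P.real {ω | τ ≤ |∑ i ∈ s, X i ω|} ≤ C * (s.card : ℝ) ^ q :=
    (mul_le_mul_of_nonneg_left h3 (by positivity)).trans (h1.trans ((le_abs_self _).trans h2))
  have hτq : 0 < τ ^ (2 * q) := by positivity
  rw [le_div_iff₀ (by positivity)]
  rw [mul_pow] at h4
  have : τ ^ (2 * q) * (P.real {ω | τ ≤ |∑ i ∈ s, X i ω|} * a ^ q) ≤ τ ^ (2 * q) * C := by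
    calc τ ^ (2 * q) * (P.real {ω | τ ≤ |∑ i ∈ s, X i ω|} * a ^ q)
        = (τ ^ (2 * q) * P.real {ω | τ ≤ |∑ i ∈ s, X i ω|}) * a ^ q := by ring
      _ ≤ (C * (s.card : ℝ) ^ q) * a ^ q := by gcongr
      _ = C * ((s.card : ℝ) ^ q * a ^ q) := by ring
      _ ≤ C * τ ^ (2 * q) := by gcongr
      _ = _ := by ring
  exact le_of_mul_le_mul_left this hτq

/-- Let the `n`-th row consist of independent centered random variables with uniformly bounded
moments, and let at most `n + 1` partial sums of it be given. Almost surely, for all large `n`,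
they are smaller than any thresholds that exceed the standard deviations by a positive power
of `n`. -/
theorem ae_eventually_partial_sums_lt (A : ℕ → ℝ) {k : ℕ → ℕ}
    {X : (n : ℕ) → Fin (k n) → Ω → ℝ} (S : (n : ℕ) → Finset (Finset (Fin (k n))))
    (τ : (n : ℕ) → Finset (Fin (k n)) → ℝ) {c b : ℝ} (hc : 0 < c) (hb : 0 < b)
    (hX : ∀ᶠ n in atTop, IsCenteredFamily P A (X n))
    (hS : ∀ n, (S n).card ≤ n + 1)
    (hτ : ∀ᶠ n : ℕ in atTop, ∀ s ∈ S n, 0 < τ n s ∧ s.card * (c * (n : ℝ) ^ b) ≤ τ n s ^ 2) :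
    ∀ᵐ ω ∂P, ∀ᶠ n in atTop, ∀ s ∈ S n, |∑ i ∈ s, X n i ω| < τ n s := by
  -- With b q ≥ 3 each sum has a tail O(n^(-3)); the union over n + 1 sums leaves the summable
  -- n^(-2).
  obtain ⟨q, hq⟩ := exists_nat_ge (3 / b)
  rw [div_le_iff₀ hb] at hq
  obtain ⟨C, hC0, hC⟩ := exists_tail_bound P A q
  obtain ⟨N, hN⟩ := eventually_atTop.1 (hX.and (hτ.and (eventually_ge_atTop 1)))
  -- The clause `N ≤ n` empties the first events, so that the bound holds for every n.
  let B : ℕ → Set Ω := fun n => {ω | N ≤ n ∧ ∃ s ∈ S n, τ n s ≤ |∑ i ∈ s, X n i ω|}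
  have hB : ∀ n, P (B n) ≤ ENNReal.ofReal (2 * C / c ^ q * (1 / (n : ℝ) ^ 2)) := by
    intro n
    by_cases hn : N ≤ n
    · obtain ⟨h1, h2, h3⟩ := hN n hn
      have hn1 : (1 : ℝ) ≤ n := by exact_mod_cast h3
      have hn0 : (0 : ℝ) < n := by linarith
      have hsub : B n ⊆ ⋃ s ∈ S n, {ω | τ n s ≤ |∑ i ∈ s, X n i ω|} := by
        rintro ω ⟨-, s, hs, h⟩
        simp only [mem_iUnion]
        exact ⟨s, hs, h⟩
      rw [← ofReal_measureReal]
      refine ENNReal.ofReal_le_ofReal ?_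
      calc P.real (B n) ≤ P.real (⋃ s ∈ S n, {ω | τ n s ≤ |∑ i ∈ s, X n i ω|}) :=
            measureReal_mono hsub (measure_ne_top _ _)
        _ ≤ ∑ s ∈ S n, P.real {ω | τ n s ≤ |∑ i ∈ s, X n i ω|} :=
            measureReal_biUnion_finset_le _ _
        _ ≤ ∑ s ∈ S n, C / (c * (n : ℝ) ^ b) ^ q := Finset.sum_le_sum fun s hs =>
            hC _ _ h1 s _ _ (h2 s hs).1 (by positivity) (h2 s hs).2
        _ = (S n).card * (C / (c * (n : ℝ) ^ b) ^ q) := by simp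
        _ ≤ (2 * n) * (C / (c ^ q * (n : ℝ) ^ 3)) := by
            have hcard : ((S n).card : ℝ) ≤ 2 * n := by
              have : ((S n).card : ℝ) ≤ n + 1 := by exact_mod_cast hS n
              linarith
            have hpow : (n : ℝ) ^ 3 ≤ ((n : ℝ) ^ b) ^ q := by
              rw [← Real.rpow_natCast ((n : ℝ) ^ b), ← Real.rpow_mul hn0.le, ← Real.rpow_natCast]
              refine Real.rpow_le_rpow_of_exponent_le hn1 ?_
              push_cast; linarith
            rw [mul_pow]
            gcongr
        _ = 2 * C / c ^ q * (1 / (n : ℝ) ^ 2) := by field_simp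
    · have : B n = ∅ := by ext ω; simp [B, hn]
      simp [this]
  have hsum : ∑' n, P (B n) ≠ ⊤ := by
    refine ne_top_of_le_ne_top ?_ (ENNReal.tsum_le_tsum hB)
    exact Summable.tsum_ofReal_ne_top
      ((Real.summable_one_div_nat_pow.2 one_lt_two).mul_left _)
  filter_upwards [ae_eventually_notMem hsum] with ω hω
  filter_upwards [hω, eventually_ge_atTop N] with n h1 h2 s hs
  by_contra hcon
  exact h1 ⟨h2, s, hs, not_lt.1 hcon⟩

end Moments

/-! ## Isotonic regression -/

theorem isotonicFit_spec {m : ℕ} (y : Fin m → ℝ) : IsIsotonicFit y (isotonicFit y) :=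
  (exists_isIsotonicFit y).choose_spec

/-- Finitely many values leave a gap below `θ`: all those under `θ` can be raised by a common
positive amount without passing it. -/
theorem exists_pos_add_le {m : ℕ} (v : Fin m → ℝ) (θ : ℝ) :
    ∃ t₀ > 0, ∀ i, v i < θ → v i + t₀ ≤ θ := by
  induction m with
  | zero => exact ⟨1, one_pos, fun i => i.elim0⟩
  | succ m ih =>
    obtain ⟨t, ht, h⟩ := ih fun i => v i.castSucc
    by_cases hl : v (Fin.last m) < θ
    · refine ⟨min t (θ - v (Fin.last m)), lt_min ht (sub_pos.2 hl), fun i => ?_⟩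
      refine Fin.lastCases (fun _ => ?_) (fun i hi => ?_) i
      · have := min_le_right t (θ - v (Fin.last m)); linarith
      · have := min_le_left t (θ - v (Fin.last m)); have := h i hi; linarith
    · refine ⟨t, ht, fun i => ?_⟩
      refine Fin.lastCases (fun h' => absurd h' hl) (fun i hi => h i hi) i

/-- First-order optimality condition: raising `v` by t on `B` changes the sum of squares by t²|B| -
2t ∑(y - v), which can be nonnegative for all small t > 0 only if the sum is nonpositive. -/
theorem sum_sub_nonpos_of_perturbation {m : ℕ} {y v : Fin m → ℝ} (B : Finset (Fin m)) {t₀ : ℝ}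
    (ht₀ : 0 < t₀)
    (h : ∀ t, 0 < t → t ≤ t₀ →
      ∑ i, (y i - v i) ^ 2 ≤ ∑ i, (y i - (v i + if i ∈ B then t else 0)) ^ 2) :
    ∑ i ∈ B, (y i - v i) ≤ 0 := by
  have key : ∀ t, 0 < t → t ≤ t₀ → 2 * ∑ i ∈ B, (y i - v i) ≤ t * B.card := by
    intro t ht htt
    have h1 := h t ht htt
    have h2 : ∑ i, (y i - (v i + if i ∈ B then t else 0)) ^ 2 =
        ∑ i, (y i - v i) ^ 2 + ∑ i ∈ B, (t ^ 2 - 2 * t * (y i - v i)) := by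
      rw [← Finset.sum_filter_add_sum_filter_not Finset.univ (· ∈ B),
        ← Finset.sum_filter_add_sum_filter_not Finset.univ (· ∈ B) (fun i => (y i - v i) ^ 2)]
      simp only [Finset.filter_mem_eq_inter, Finset.univ_inter]
      have e1 : ∑ i ∈ B, (y i - (v i + if i ∈ B then t else 0)) ^ 2 =
          ∑ i ∈ B, (y i - v i) ^ 2 + ∑ i ∈ B, (t ^ 2 - 2 * t * (y i - v i)) := by
        rw [← Finset.sum_add_distrib]
        refine Finset.sum_congr rfl fun i hi => ?_
        rw [if_pos hi]; ring
      have e2 : ∑ i with i ∉ B, (y i - (v i + if i ∈ B then t else 0)) ^ 2 =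
          ∑ i with i ∉ B, (y i - v i) ^ 2 := by
        refine Finset.sum_congr rfl fun i hi => ?_
        rw [if_neg (Finset.mem_filter.1 hi).2, add_zero]
      rw [e1, e2]; ring
    rw [h2, Finset.sum_sub_distrib, ← Finset.mul_sum] at h1
    simp only [Finset.sum_const, nsmul_eq_mul] at h1
    have h3 : t * (2 * ∑ i ∈ B, (y i - v i)) ≤ t * (t * B.card) := by nlinarith
    exact le_of_mul_le_mul_left h3 ht
  by_contra hcon
  push Not at hcon
  set s := ∑ i ∈ B, (y i - v i)
  have hc : (0 : ℝ) ≤ B.card := Nat.cast_nonneg _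
  have h1 := key (min t₀ (s / (B.card + 1))) (lt_min ht₀ (by positivity)) (min_le_left _ _)
  have h2 : min t₀ (s / (B.card + 1)) * B.card ≤ s / (B.card + 1) * B.card :=
    mul_le_mul_of_nonneg_right (min_le_right _ _) hc
  have h3 : s / (B.card + 1) * B.card ≤ s := by
    rw [div_mul_eq_mul_div, div_le_iff₀ (by positivity)]
    nlinarith
  linarith

/-- To the right of a cut point, the responses whose fitted value is below `θ` have an average of
at most `θ`. -/
theorem IsIsotonicFit.sum_le_of_isUpperSet {m : ℕ} {y v : Fin m → ℝ} (h : IsIsotonicFit y v)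
    (θ : ℝ) {D : Set (Fin m)} (hD : IsUpperSet D) {B : Finset (Fin m)}
    (hB : ∀ i, i ∈ B ↔ i ∈ D ∧ v i < θ) : ∑ i ∈ B, y i ≤ B.card * θ := by
  obtain ⟨t₀, ht₀, hgap⟩ := exists_pos_add_le v θ
  -- Raising the fit on `B` by t ≤ t₀ keeps it monotone: an index above `B` but outside it has a
  -- fitted value of at least `θ`, which the raised values do not pass.
  have h1 : ∑ i ∈ B, (y i - v i) ≤ 0 := by
    refine sum_sub_nonpos_of_perturbation B ht₀ fun t ht htt => h.2 _ fun i j hij => ?_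
    have hv := h.1 hij
    split_ifs with hi hj hj
    · linarith
    · have hi' := (hB i).1 hi
      have hj' : θ ≤ v j := not_lt.1 fun hlt => hj ((hB j).2 ⟨hD hij hi'.1, hlt⟩)
      have := hgap i hi'.2
      linarith
    · linarith
    · linarith
  rw [Finset.sum_sub_distrib] at h1
  have h2 : ∑ i ∈ B, v i ≤ ∑ _i ∈ B, θ := Finset.sum_le_sum fun i hi => ((hB i).1 hi).2.le
  simp only [Finset.sum_const, nsmul_eq_mul] at h2
  linarith

/-- To the left of a cut point, the responses whose fitted value is at least `θ` have an average of
at least `θ`. -/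
theorem IsIsotonicFit.le_sum_of_isLowerSet {m : ℕ} {y v : Fin m → ℝ} (h : IsIsotonicFit y v)
    (θ : ℝ) {D : Set (Fin m)} (hD : IsLowerSet D) {B : Finset (Fin m)}
    (hB : ∀ i, i ∈ B ↔ i ∈ D ∧ θ ≤ v i) : B.card * θ ≤ ∑ i ∈ B, y i := by
  obtain ⟨t₀, ht₀, hgap⟩ := exists_pos_add_le v θ
  -- Mirror image: the fit is lowered on `B`, which is the same perturbation after a change of sign.
  have h1 : ∑ i ∈ B, (-y i - -v i) ≤ 0 := by
    refine sum_sub_nonpos_of_perturbation (y := fun i => -y i) (v := fun i => -v i) B ht₀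
      fun t ht htt => ?_
    have h2 := h.2 (fun i => v i - if i ∈ B then t else 0) fun i j hij => ?_
    · convert h2 using 2 <;> ring
    · have hv := h.1 hij
      dsimp only
      split_ifs with hi hj hj
      · linarith
      · linarith
      · have hj' := (hB j).1 hj
        have hi' : v i < θ := not_le.1 fun hle => hi ((hB i).2 ⟨hD hij hj'.1, hle⟩)
        have := hgap i hi'
        linarith
      · linarith
  simp only [Finset.sum_sub_distrib, Finset.sum_neg_distrib] at h1
  have h2 : ∑ _i ∈ B, θ ≤ ∑ i ∈ B, v i := Finset.sum_le_sum fun i hi => ((hB i).1 hi).2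
  simp only [Finset.sum_const, nsmul_eq_mul] at h2
  linarith

theorem levelInverse_le {g : ℝ → ℝ} {θ t : ℝ} (ht : t ∈ Icc (0 : ℝ) 1) (h : θ ≤ g t) :
    levelInverse g θ ≤ t := by
  refine csInf_le ⟨0, ?_⟩ (mem_insert_of_mem _ ⟨ht, h⟩)
  rintro t (rfl | ht)
  · exact zero_le_one
  · exact ht.1.1

theorem exists_of_levelInverse_lt {g : ℝ → ℝ} {θ s : ℝ} (hs : s ≤ 1) (h : levelInverse g θ < s) :
    ∃ t ∈ Icc (0 : ℝ) 1, t < s ∧ θ ≤ g t := by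
  obtain ⟨t, ht, hts⟩ := exists_lt_of_csInf_lt ⟨1, mem_insert _ _⟩ h
  -- The default value 1 is excluded by t < s ≤ 1.
  rcases ht with rfl | ht
  · linarith
  · exact ⟨t, ht.1, hts, ht.2⟩

theorem isotonicFit_le_isotonicRegression {m : ℕ} (x y : Fin m → ℝ) (i : Fin m) :
    isotonicFit y i ≤ isotonicRegression x y (x i) := by
  have h : ∃ j, x j ≤ x i := ⟨i, le_rfl⟩
  rw [isotonicRegression, if_pos h]
  exact le_ciSup (f := fun j : {j // x j ≤ x i} => isotonicFit y j) (Set.finite_range _).bddAbove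
    ⟨i, le_rfl⟩

/-- Where the isotonic regression is at least `θ`, so are the fitted values further to the
right. -/
theorem le_isotonicFit_of_le_isotonicRegression {m : ℕ} {x y : Fin m → ℝ} (hx : StrictMono x)
    {t θ : ℝ} (h : θ ≤ isotonicRegression x y t) {i : Fin m} (hi : t < x i) :
    θ ≤ isotonicFit y i := by
  have hmono := (isotonicFit_spec y).1
  rw [isotonicRegression] at h
  split_ifs at h with hex
  · obtain ⟨j, hj⟩ := hex
    have : Nonempty {j // x j ≤ t} := ⟨⟨j, hj⟩⟩
    refine h.trans (ciSup_le fun k => hmono (hx.le_iff_le.1 (k.2.trans hi.le)))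
  · exact h.trans (ciInf_le (Set.finite_range _).bddBelow i)

/-! ## Counting design points -/

/-- The continuous positive density attains a positive minimum g₀ on [0,1], so G gives (s,t] mass at
least g₀(t - s). Replacing G by the empirical distribution function at both end points costs O(√m)
points. -/
theorem IsRegularDesign.exists_card_ge {x : (m : ℕ) → Fin m → ℝ} (hx : IsRegularDesign x) :
    ∃ g₀ C : ℝ, 0 < g₀ ∧ 0 ≤ C ∧ ∀ m : ℕ, 0 < m → ∀ s t : ℝ, 0 ≤ s → s ≤ t → t ≤ 1 →
      g₀ * (t - s) * m - C * √m ≤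
        ((Finset.univ.filter fun i => s < x m i ∧ x m i ≤ t).card : ℝ) := by
  obtain ⟨ν, g, hν, hgm, hg0, rfl, hgpos, hgd, -, C, hC⟩ := hx
  obtain ⟨u, hu, hmin⟩ := isCompact_Icc.exists_isMinOn (nonempty_Icc.2 zero_le_one)
    hgd.continuousOn
  refine ⟨g u, 2 * |C|, hgpos u hu, by positivity, fun m hm s t hs hst ht => ?_⟩
  set ν := volume.withDensity fun t => ENNReal.ofReal (g t)
  have h1 : g u * (t - s) ≤ cdf ν t - cdf ν s := by
    have e1 : ν.real (Ioc s t) = cdf ν t - cdf ν s := by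
      rw [cdf_eq_real, cdf_eq_real, ← Iic_sdiff_Iic,
        measureReal_sdiff (Iic_subset_Iic.2 hst) measurableSet_Iic]
    rw [← e1, measureReal_def]
    refine (ENNReal.ofReal_le_iff_le_toReal (measure_ne_top _ _)).1 ?_
    rw [withDensity_apply _ measurableSet_Ioc]
    calc ENNReal.ofReal (g u * (t - s)) = ∫⁻ _ in Ioc s t, ENNReal.ofReal (g u) := by
          rw [setLIntegral_const, Real.volume_Ioc, ENNReal.ofReal_mul (hg0 u)]
      _ ≤ ∫⁻ a in Ioc s t, ENNReal.ofReal (g a) := by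
          refine setLIntegral_mono (by fun_prop) fun a ha => ENNReal.ofReal_le_ofReal ?_
          exact hmin ⟨hs.trans ha.1.le, ha.2.trans ht⟩
  have h2 : ((Finset.univ.filter fun i => s < x m i ∧ x m i ≤ t).card : ℝ) =
      m * (empiricalCDF (x m) t - empiricalCDF (x m) s) := by
    have hm' : (m : ℝ) ≠ 0 := by positivity
    unfold empiricalCDF
    rw [← sub_div, mul_div_cancel₀ _ hm', eq_sub_iff_add_eq, ← Nat.cast_add]
    congr 1
    rw [← Finset.card_union_of_disjoint]
    · congr 1
      ext i
      simp only [Finset.mem_union, Finset.mem_filter, Finset.mem_univ, true_and]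
      constructor
      · rintro (h | h)
        · exact h.2
        · exact h.trans hst
      · intro h
        rcases lt_or_ge s (x m i) with h' | h'
        · exact Or.inl ⟨h', h⟩
        · exact Or.inr h'
    · rw [Finset.disjoint_filter]
      rintro i - h1 h2
      exact absurd h1.1 (not_lt.2 h2)
  have hm0 : (0 : ℝ) < m := by exact_mod_cast hm
  have h3 := abs_le.1 (hC m hm t ⟨hs.trans hst, ht⟩)
  have h4 := abs_le.1 (hC m hm s ⟨hs, hst.trans ht⟩)
  have h5 : C / √m ≤ |C| / √m := by gcongr; exact le_abs_self C
  have h6 : (m : ℝ) * (|C| / √m) = |C| * √m := by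
    have := Real.sq_sqrt hm0.le
    field_simp
    rw [this]; ring
  rw [h2]
  have h7 : g u * (t - s) - 2 * (|C| / √m) ≤ empiricalCDF (x m) t - empiricalCDF (x m) s := by
    linarith [h3.1, h4.2]
  nlinarith [mul_le_mul_of_nonneg_left h7 hm0.le]

/-! ## The crossing point of the isotonic regression -/

section Crossing

variable {f : ℝ → ℝ} {d₀ p a h : ℝ} {x : (m : ℕ) → Fin m → ℝ} {n : ℕ} {e : ℕ → ℝ}

/-- The data-dependent block where the fit is below `θ` is thus described by one integer k ≤ m. This
keeps the later union bound at m + 1 events instead of all subsets. -/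
theorem filter_lt_eq_of_monotone {m : ℕ} {v : Fin m → ℝ} (hv : Monotone v) (θ : ℝ) :
    ∃ k ≤ m, ∀ i : Fin m, v i < θ ↔ (i : ℕ) < k := by
  induction m with
  | zero => exact ⟨0, le_rfl, fun i => i.elim0⟩
  | succ m ih =>
    by_cases hl : v (Fin.last m) < θ
    · exact ⟨m + 1, le_rfl, fun i => ⟨fun _ => i.2, fun _ => (hv (Fin.le_last i)).trans_lt hl⟩⟩
    · obtain ⟨k, hk, h⟩ := ih (v := fun i => v i.castSucc) fun i j hij => hv hij
      refine ⟨k, hk.trans m.le_succ, fun i => ?_⟩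
      refine Fin.lastCases ?_ (fun i => h i) i
      simp only [hl, Fin.val_last, false_iff, not_lt]
      exact hk

/-- If the first-stage estimator exceeds `d₀ + h`, a partial sum of the errors is large. -/
theorem exists_sum_le_of_lt_firstEstimate (hx : IsDesignArray x) (ha : 0 ≤ a)
    (hslope : ∀ t ∈ Icc (0 : ℝ) 1, d₀ ≤ t → a * (t - d₀) ≤ f t - f d₀)
    (hh : 0 < h) (hlt : d₀ + h < firstEstimate f d₀ p x n e) :
    ∃ k ≤ firstSize p n, ∃ B : Finset (Fin (firstSize p n)),
      B = (Finset.univ.filter fun i => d₀ + h / 2 < x (firstSize p n) i ∧ (i : ℕ) < k) ∧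
      (Finset.univ.filter fun i => d₀ + h / 2 < x (firstSize p n) i ∧
        x (firstSize p n) i ≤ d₀ + h) ⊆ B ∧
      ∑ i ∈ B, e i ≤ -(B.card * (a * h / 2)) := by
  set m := firstSize p n with hm
  set y : Fin m → ℝ := fun i => f (x m i) + e i with hy
  have hfit := isotonicFit_spec y
  obtain ⟨k, hk, hkk⟩ := filter_lt_eq_of_monotone hfit.1 (f d₀)
  -- Cutting halfway serves two purposes: on `B` the regression function exceeds its value at d₀ by
  -- a h/2, and `B` contains every design point of an interval of length h/2.
  set B : Finset (Fin m) := Finset.univ.filter fun i => d₀ + h / 2 < x m i ∧ (i : ℕ) < k with hB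
  have hmem : ∀ i, i ∈ B ↔ i ∈ {i | d₀ + h / 2 < x m i} ∧ isotonicFit y i < f d₀ := by
    intro i
    simp [hB, hkk]
  refine ⟨k, hk, B, rfl, ?_, ?_⟩
  · intro i hi
    simp only [Finset.mem_filter, Finset.mem_univ, true_and] at hi
    refine (hmem i).2 ⟨hi.1, not_le.1 fun hle => ?_⟩
    have h1 := isotonicFit_le_isotonicRegression (x m) y i
    have h2 : firstEstimate f d₀ p x n e ≤ x m i := levelInverse_le ((hx m).2 i) (hle.trans h1)
    linarith [hi.2]
  · have h1 := hfit.sum_le_of_isUpperSet (f d₀) (D := {i | d₀ + h / 2 < x m i})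
      (fun i j hij hi => lt_of_lt_of_le hi ((hx m).1.monotone hij)) hmem
    have h2 : ∑ i ∈ B, (f d₀ + a * h / 2) ≤ ∑ i ∈ B, f (x m i) := by
      refine Finset.sum_le_sum fun i hi => ?_
      have h3 : d₀ + h / 2 < x m i := ((hmem i).1 hi).1
      have h4 := hslope _ ((hx m).2 i) (by linarith)
      nlinarith
    simp only [hy, Finset.sum_add_distrib] at h1
    simp only [Finset.sum_const, nsmul_eq_mul, mul_add] at h2
    linarith

/-- If the first-stage estimator is below `d₀ - h`, a partial sum of the errors is large. -/
theorem exists_le_sum_of_firstEstimate_lt (hx : IsDesignArray x) (ha : 0 ≤ a)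
    (hslope : ∀ t ∈ Icc (0 : ℝ) 1, t ≤ d₀ → a * (d₀ - t) ≤ f d₀ - f t)
    (hh : 0 < h) (hd : d₀ ≤ 1) (hlt : firstEstimate f d₀ p x n e < d₀ - h) :
    ∃ k ≤ firstSize p n, ∃ B : Finset (Fin (firstSize p n)),
      B = (Finset.univ.filter fun i => x (firstSize p n) i ≤ d₀ - h / 2 ∧ k ≤ (i : ℕ)) ∧
      (Finset.univ.filter fun i => d₀ - h < x (firstSize p n) i ∧
        x (firstSize p n) i ≤ d₀ - h / 2) ⊆ B ∧
      B.card * (a * h / 2) ≤ ∑ i ∈ B, e i := by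
  set m := firstSize p n with hm
  set y : Fin m → ℝ := fun i => f (x m i) + e i with hy
  have hfit := isotonicFit_spec y
  obtain ⟨k, hk, hkk⟩ := filter_lt_eq_of_monotone hfit.1 (f d₀)
  set B : Finset (Fin m) := Finset.univ.filter fun i => x m i ≤ d₀ - h / 2 ∧ k ≤ (i : ℕ) with hB
  have hmem : ∀ i, i ∈ B ↔ i ∈ {i | x m i ≤ d₀ - h / 2} ∧ f d₀ ≤ isotonicFit y i := by
    intro i
    simp only [hB, Finset.mem_filter, Finset.mem_univ, true_and, mem_ofPred_eq]
    rw [← not_lt (a := isotonicFit y i), hkk, not_lt]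
  obtain ⟨t, -, ht, hgt⟩ := exists_of_levelInverse_lt (by linarith) hlt
  refine ⟨k, hk, B, rfl, ?_, ?_⟩
  · intro i hi
    simp only [Finset.mem_filter, Finset.mem_univ, true_and] at hi
    exact (hmem i).2 ⟨hi.2,
      le_isotonicFit_of_le_isotonicRegression (hx m).1 hgt (ht.trans hi.1)⟩
  · have h1 := hfit.le_sum_of_isLowerSet (f d₀) (D := {i | x m i ≤ d₀ - h / 2})
      (fun i j hij hi => ((hx m).1.monotone hij).trans hi) hmem
    have h2 : ∑ i ∈ B, f (x m i) ≤ ∑ i ∈ B, (f d₀ - a * h / 2) := by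
      refine Finset.sum_le_sum fun i hi => ?_
      have h3 : x m i ≤ d₀ - h / 2 := ((hmem i).1 hi).1
      have h4 := hslope _ ((hx m).2 i) (by linarith)
      nlinarith
    simp only [hy, Finset.sum_add_distrib] at h1
    simp only [Finset.sum_const, nsmul_eq_mul, mul_sub] at h2
    linarith

end Crossing

/-! ## Sample sizes -/

section Sizes

variable {p : ℝ}

theorem floor_le_firstSize (p : ℝ) (n : ℕ) : ⌊(n : ℝ) * p⌋₊ ≤ firstSize p n := by
  unfold firstSize; split_ifs <;> omega

theorem firstSize_le_floor (p : ℝ) (n : ℕ) : firstSize p n ≤ ⌊(n : ℝ) * p⌋₊ + 1 := by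
  unfold firstSize; split_ifs <;> omega

theorem firstSize_lower (p : ℝ) (n : ℕ) : n * p - 1 ≤ firstSize p n := by
  have h1 : (⌊(n : ℝ) * p⌋₊ : ℝ) ≤ firstSize p n := by exact_mod_cast floor_le_firstSize p n
  have := Nat.sub_one_lt_floor ((n : ℝ) * p)
  linarith

theorem firstSize_upper (hp : 0 ≤ p) (n : ℕ) : firstSize p n ≤ n * p + 1 := by
  have h1 : (firstSize p n : ℝ) ≤ ⌊(n : ℝ) * p⌋₊ + 1 := by exact_mod_cast firstSize_le_floor p n
  have := Nat.floor_le (a := (n : ℝ) * p) (by positivity)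
  linarith

theorem eventually_half_mul_le_firstSize (hp : 0 < p) :
    ∀ᶠ n : ℕ in atTop, p / 2 * n ≤ firstSize p n := by
  filter_upwards [tendsto_natCast_atTop_atTop.eventually_ge_atTop (2 / p)] with n hn
  rw [div_le_iff₀ hp] at hn
  linarith [firstSize_lower p n]

theorem eventually_firstSize_le (hp : 0 ≤ p) (hp1 : p < 1) :
    ∀ᶠ n : ℕ in atTop, firstSize p n ≤ n := by
  filter_upwards [tendsto_natCast_atTop_atTop.eventually_ge_atTop (1 / (1 - p))] with n hn
  rw [div_le_iff₀ (by linarith)] at hn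
  have := firstSize_upper hp n
  exact_mod_cast (show (firstSize p n : ℝ) ≤ n by linarith)

theorem secondSize_le (p : ℝ) (n : ℕ) : secondSize p n ≤ n := by
  unfold secondSize; omega

theorem tendsto_secondSize_div (hp : 0 < p) (hp1 : p < 1) :
    Tendsto (fun n : ℕ => (secondSize p n : ℝ) / n) atTop (𝓝 ((1 - p) / 2)) := by
  have hinv : Tendsto (fun n : ℕ => (1 : ℝ) / n) atTop (𝓝 0) := tendsto_one_div_atTop_nhds_zero_nat
  have hlow : Tendsto (fun n : ℕ => (1 - p) / 2 - 1 * (1 / (n : ℝ))) atTop (𝓝 ((1 - p) / 2)) := by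
    simpa using (tendsto_const_nhds (x := (1 - p) / 2)).sub (hinv.const_mul 1)
  have hup : Tendsto (fun n : ℕ => (1 - p) / 2 + 1 * (1 / (n : ℝ))) atTop (𝓝 ((1 - p) / 2)) := by
    simpa using (tendsto_const_nhds (x := (1 - p) / 2)).add (hinv.const_mul 1)
  refine tendsto_of_tendsto_of_tendsto_of_le_of_le' hlow hup ?_ ?_
  all_goals
    filter_upwards [eventually_firstSize_le hp.le hp1, eventually_gt_atTop 0] with n h1 h2
    have hn : (0 : ℝ) < n := by exact_mod_cast h2
    have hl := firstSize_lower p n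
    have hu := firstSize_upper hp.le n
    have hs : secondSize p n = (n - firstSize p n) / 2 := rfl
    have h3 : 2 * secondSize p n + firstSize p n ≤ n := by omega
    -- A rounding loss of one observation is harmless in the limit, so parity need not be tracked.
    have h4 : n ≤ 2 * secondSize p n + firstSize p n + 1 := by omega
    have h3' : 2 * (secondSize p n : ℝ) + firstSize p n ≤ n := by exact_mod_cast h3
    have h4' : (n : ℝ) ≤ 2 * (secondSize p n : ℝ) + firstSize p n + 1 := by exact_mod_cast h4
  · rw [le_div_iff₀ hn, sub_mul]
    have : 1 * (1 / (n : ℝ)) * n = 1 := by field_simp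
    linarith
  · rw [div_le_iff₀ hn, add_mul]
    have : 1 * (1 / (n : ℝ)) * n = 1 := by field_simp
    linarith

theorem eventually_mul_le_secondSize (hp : 0 < p) (hp1 : p < 1) :
    ∀ᶠ n : ℕ in atTop, (1 - p) / 4 * n ≤ secondSize p n := by
  filter_upwards [(tendsto_secondSize_div hp hp1).eventually_const_le
    (show (1 - p) / 4 < (1 - p) / 2 by linarith), eventually_gt_atTop 0] with n h1 h2
  rwa [le_div_iff₀ (by exact_mod_cast h2)] at h1

end Sizes

/-! ## Almost sure behaviour of the errors and of the first-stage estimator -/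

section AlmostSure

variable {Ω : Type*} [MeasurableSpace Ω] {P : Measure Ω}
  {μ : Measure ℝ} {ε ε' ε'' : ℕ → ℕ → Ω → ℝ}

/-- The moment bounds are moments under `μ`, hence the same for all rows, as Borel–Cantelli
requires. The index `j` selects the first-stage errors or those at L or at U. -/
theorem IsErrorArray.isCenteredFamily (hε : IsErrorArray P μ ε ε' ε'') {n k : ℕ} (hk : k ≤ n)
    (j : Fin 3) {φ : ℝ → ℝ} (hφ : Measurable φ) (hint : ∀ r : ℕ, Integrable (fun z => |φ z| ^ r) μ)
    (hmean : ∫ z, φ z ∂μ = 0) :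
    IsCenteredFamily P (fun r => ∫ z, |φ z| ^ r ∂μ)
      (fun (i : Fin k) ω => φ ((![ε n, ε' n, ε'' n] j : ℕ → Ω → ℝ) i ω)) := by
  have hlaw : ∀ i : Fin k, HasLaw ((![ε n, ε' n, ε'' n] j : ℕ → Ω → ℝ) i) μ P := by
    intro i
    have := hε.law n i (i.2.trans_le hk)
    fin_cases j
    · exact this.1
    · exact this.2.1
    · exact this.2.2
  have hmap : ∀ (i : Fin k) (ψ : ℝ → ℝ), Measurable ψ →
      ∫ ω, ψ ((![ε n, ε' n, ε'' n] j : ℕ → Ω → ℝ) i ω) ∂P = ∫ z, ψ z ∂μ := by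
    intro i ψ hψ
    rw [← (hlaw i).map_eq, integral_map (hlaw i).aemeasurable hψ.aestronglyMeasurable]
  refine ⟨?_, fun i => hφ.comp_aemeasurable (hlaw i).aemeasurable, fun i r => ?_, fun i => ?_,
    fun i r => (hmap i (fun z => |φ z| ^ r) (by fun_prop)).le⟩
  · have h1 := (hε.indep n).precomp (g := fun i : Fin k => (j, Fin.castLE hk i))
      (fun a b hab => by simpa using hab)
    exact h1.comp (fun _ => φ) fun _ => hφ
  · have h1 := hint r
    rw [← (hlaw i).map_eq] at h1
    exact h1.comp_aemeasurable (hlaw i).aemeasurable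
  · rw [hmap i φ hφ, hmean]

theorem rpow_one_sub_natCast_mul {t : ℝ} (ht : 0 < t) (k : ℕ) (a : ℝ) :
    t ^ (1 - k * a) = t * (t ^ (-a)) ^ k := by
  rw [show 1 - k * a = 1 + -a * k by ring, Real.rpow_add ht, Real.rpow_one, Real.rpow_mul ht.le,
    Real.rpow_natCast]

variable [IsProbabilityMeasure P]

/-- Strong law with rate for the averages along the second-stage errors. -/
theorem IsErrorArray.ae_tendsto_mean (hε : IsErrorArray P μ ε ε' ε'') (j : Fin 3) {p : ℝ}
    (hp : p ∈ Ioo (0 : ℝ) 1) {φ : ℝ → ℝ} (hφ : Measurable φ)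
    (hint : ∀ r : ℕ, Integrable (fun z => |φ z| ^ r) μ) (hmean : ∫ z, φ z ∂μ = 0)
    {a : ℝ} (ha : a < 1 / 2) :
    ∀ᵐ ω ∂P, Tendsto (fun n : ℕ => (n : ℝ) ^ a *
      mean fun i : Fin (secondSize p n) => φ ((![ε n, ε' n, ε'' n] j : ℕ → Ω → ℝ) i ω))
      atTop (𝓝 0) := by
  have hall : ∀ N : ℕ, ∀ᵐ ω ∂P, ∀ᶠ n : ℕ in atTop, |(n : ℝ) ^ a *
      mean fun i : Fin (secondSize p n) => φ ((![ε n, ε' n, ε'' n] j : ℕ → Ω → ℝ) i ω)| <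
        1 / ((N : ℝ) + 1) := by
    intro N
    set η : ℝ := 1 / ((N : ℝ) + 1) with hη
    have hη0 : 0 < η := by positivity
    have hp4 : 0 < (1 - p) / 4 := by linarith [hp.2]
    -- With k ≥ (1 - p)n/4 summands, the squared threshold η²k²n^(-2a) is at least k · η²(1 - p)/4 ·
    -- n^(1 - 2a), and 1 - 2a > 0.
    have key := ae_eventually_partial_sums_lt (P := P) (fun r => ∫ z, |φ z| ^ r ∂μ)
      (k := fun n => secondSize p n)
      (X := fun n (i : Fin (secondSize p n)) ω => φ ((![ε n, ε' n, ε'' n] j : ℕ → Ω → ℝ) i ω))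
      (fun n => {Finset.univ}) (fun n _ => η * secondSize p n * (n : ℝ) ^ (-a))
      (c := η ^ 2 * ((1 - p) / 4)) (b := 1 - 2 * a) (by positivity) (by linarith)
      (Eventually.of_forall fun n => hε.isCenteredFamily (secondSize_le p n) j hφ hint hmean)
      (fun n => by simp) ?_
    · filter_upwards [key] with ω hω
      filter_upwards [hω, eventually_mul_le_secondSize hp.1 hp.2, eventually_gt_atTop 0]
        with n h1 h2 h3
      have hn : (0 : ℝ) < n := by exact_mod_cast h3
      have hk : (0 : ℝ) < secondSize p n := lt_of_lt_of_le (by positivity) h2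
      have h4 := h1 _ (Finset.mem_singleton_self _)
      have hna : 0 < (n : ℝ) ^ a := Real.rpow_pos_of_pos hn a
      rw [mean, abs_mul, abs_div, abs_of_pos hna, Nat.abs_cast, ← mul_div_assoc, div_lt_iff₀ hk]
      calc (n : ℝ) ^ a * |∑ i : Fin (secondSize p n),
              φ ((![ε n, ε' n, ε'' n] j : ℕ → Ω → ℝ) i ω)|
          < (n : ℝ) ^ a * (η * secondSize p n * (n : ℝ) ^ (-a)) := by gcongr
        _ = η * secondSize p n := by
          rw [Real.rpow_neg hn.le]; field_simp
    · filter_upwards [eventually_mul_le_secondSize hp.1 hp.2, eventually_gt_atTop 0]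
        with n h2 h3 s hs
      have hn : (0 : ℝ) < n := by exact_mod_cast h3
      have hk : (0 : ℝ) < secondSize p n := lt_of_lt_of_le (by positivity) h2
      rw [Finset.mem_singleton] at hs
      subst hs
      refine ⟨by positivity, ?_⟩
      have e1 : (n : ℝ) ^ (1 - 2 * a) = n * ((n : ℝ) ^ (-a)) ^ 2 :=
        mod_cast rpow_one_sub_natCast_mul hn 2 a
      rw [e1, Finset.card_univ, Fintype.card_fin]
      calc (secondSize p n : ℝ) * (η ^ 2 * ((1 - p) / 4) * (n * ((n : ℝ) ^ (-a)) ^ 2))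
          = (secondSize p n : ℝ) * ((1 - p) / 4 * n) * (η ^ 2 * ((n : ℝ) ^ (-a)) ^ 2) := by ring
        _ ≤ (secondSize p n : ℝ) * secondSize p n * (η ^ 2 * ((n : ℝ) ^ (-a)) ^ 2) := by gcongr
        _ = _ := by ring
  filter_upwards [ae_all_iff.2 hall] with ω hω
  rw [Metric.tendsto_atTop']
  intro δ hδ
  obtain ⟨N, hN⟩ := exists_nat_one_div_lt hδ
  obtain ⟨n₀, hn₀⟩ := eventually_atTop.1 (hω N)
  exact ⟨n₀, fun n hn => by
    rw [Real.dist_eq, sub_zero]; exact (hn₀ n hn.le).trans hN⟩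

theorem slope_bounds {f : ℝ → ℝ} (hf : HasBoundedSlope f) :
    ∃ a > 0, ∀ s ∈ Icc (0 : ℝ) 1, ∀ t ∈ Icc (0 : ℝ) 1, s ≤ t → a * (t - s) ≤ f t - f s := by
  obtain ⟨hd, a, b, ha, hab⟩ := hf
  refine ⟨a, ha, fun s hs t ht hst => ?_⟩
  refine (convex_Icc (0 : ℝ) 1).mul_sub_le_image_sub_of_le_deriv hd.continuousOn
    (hd.mono interior_subset) (fun u hu => ?_) s hs t ht hst
  have h1 : Icc (0 : ℝ) 1 ∈ 𝓝 u := mem_interior_iff_mem_nhds.1 hu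
  rw [← derivWithin_of_mem_nhds h1]
  exact (hab u (interior_subset hu)).1

/-- The first-stage estimator is almost surely consistent, with rate `o(n ^ (-γ))`. -/
theorem ae_tendsto_firstEstimate (hε : IsErrorArray P μ ε ε' ε'')
    (hmom : HasAllMoments μ) (hmean : ∫ z, z ∂μ = 0) {f : ℝ → ℝ} (hf : HasBoundedSlope f)
    {d₀ p γ : ℝ} (hd₀ : d₀ ∈ Ioo (0 : ℝ) 1) (hp : p ∈ Ioo (0 : ℝ) 1)
    (hγ : γ ∈ Ioo (0 : ℝ) (1 / 3)) {x : (m : ℕ) → Fin m → ℝ} (hx : IsDesignArray x)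
    (hxG : IsRegularDesign x) :
    ∀ᵐ ω ∂P, Tendsto (fun n : ℕ => (n : ℝ) ^ γ * (firstEstimate f d₀ p x n (fun i => ε n i ω) - d₀))
      atTop (𝓝 0) := by
  obtain ⟨a, ha, hslope⟩ := slope_bounds hf
  obtain ⟨g₀, C, hg₀, hC, hcount⟩ := hxG.exists_card_ge
  have hp0 := hp.1
  have hfam : ∀ᶠ n : ℕ in atTop, IsCenteredFamily P (fun r => ∫ z, |z| ^ r ∂μ)
      (fun (i : Fin (firstSize p n)) ω => ε n i ω) := by
    filter_upwards [eventually_firstSize_le hp.1.le hp.2] with n hn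
    exact hε.isCenteredFamily hn 0 measurable_id hmom hmean
  have hall : ∀ N : ℕ, ∀ᵐ ω ∂P, ∀ᶠ n : ℕ in atTop,
      |firstEstimate f d₀ p x n (fun i => ε n i ω) - d₀| ≤
        1 / ((N : ℝ) + 1) * (n : ℝ) ^ (-γ) := by
    intro N
    set η : ℝ := 1 / ((N : ℝ) + 1) with hη
    have hη0 : 0 < η := by positivity
    set h : ℕ → ℝ := fun n => η * (n : ℝ) ^ (-γ) with hh
    have hrpow : Tendsto (fun n : ℕ => (n : ℝ) ^ (-γ)) atTop (𝓝 0) :=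
      (tendsto_rpow_neg_atTop hγ.1).comp tendsto_natCast_atTop_atTop
    have hh0 : Tendsto h atTop (𝓝 0) := by simpa using hrpow.const_mul η
    -- An interval of length h/2 contains at least g₀ h n₁/2 - C√n₁ design points; `u` is half of
    -- the main term, and the other half absorbs C√n₁ for large n.
    set u : ℕ → ℝ := fun n => g₀ * h n * firstSize p n / 4 with hu
    have hlarge : ∀ᶠ n : ℕ in atTop, C * √(firstSize p n) ≤ u n := by
      have h1 : Tendsto (fun n : ℕ => (n : ℝ) ^ (1 / 2 - γ)) atTop atTop :=
        (tendsto_rpow_atTop (by linarith [hγ.2])).comp tendsto_natCast_atTop_atTop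
      filter_upwards [h1.eventually_ge_atTop (4 * C / (g₀ * η * √(p / 2))),
        eventually_half_mul_le_firstSize hp0, eventually_gt_atTop 0] with n h2 h3 h4
      have hn : (0 : ℝ) < n := by exact_mod_cast h4
      have hs : √(p / 2) * √n ≤ √(firstSize p n) := by
        rw [← Real.sqrt_mul (by positivity)]; exact Real.sqrt_le_sqrt h3
      have e1 : (n : ℝ) ^ (1 / 2 - γ) = √n * (n : ℝ) ^ (-γ) := by
        rw [Real.sqrt_eq_rpow, ← Real.rpow_add hn, sub_eq_add_neg]
      rw [div_le_iff₀ (by positivity), e1] at h2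
      have h5 : 4 * C ≤ g₀ * h n * √(firstSize p n) := by
        calc 4 * C ≤ √n * (n : ℝ) ^ (-γ) * (g₀ * η * √(p / 2)) := h2
          _ = g₀ * h n * (√(p / 2) * √n) := by simp only [hh]; ring
          _ ≤ _ := by gcongr
      have h6 := mul_le_mul_of_nonneg_right h5 (Real.sqrt_nonneg (firstSize p n))
      rw [mul_assoc (g₀ * h n), Real.mul_self_sqrt (Nat.cast_nonneg _)] at h6
      simp only [hu]
      linarith
    -- The squared threshold divided by |s| is |s|(a h/2)² ≥ u (a h/2)², of order n h³ = η³ n^(1 -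
    -- 3γ). The constant 32 comes from n₁ ≥ p n/2, the 4 in `u` and the square of a h/2.
    have hthr : ∀ᶠ n : ℕ in atTop, ∀ s : Finset (Fin (firstSize p n)), u n ≤ s.card →
        0 < (s.card : ℝ) * (a * h n / 2) ∧
          s.card * (g₀ * p * a ^ 2 * η ^ 3 / 32 * (n : ℝ) ^ (1 - 3 * γ)) ≤
            ((s.card : ℝ) * (a * h n / 2)) ^ 2 := by
      filter_upwards [eventually_half_mul_le_firstSize hp0, eventually_gt_atTop 0] with n h3 h4 s hs
      have hn : (0 : ℝ) < n := by exact_mod_cast h4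
      have hm : (0 : ℝ) < firstSize p n := lt_of_lt_of_le (by positivity) h3
      have hun : 0 < u n := by positivity
      have hcard := hun.trans_le hs
      refine ⟨by positivity, ?_⟩
      have e1 : (n : ℝ) ^ (1 - 3 * γ) = n * ((n : ℝ) ^ (-γ)) ^ 3 :=
        mod_cast rpow_one_sub_natCast_mul hn 3 γ
      have h5 : g₀ * h n * (p / 2 * n) / 4 ≤ s.card := by
        refine le_trans ?_ hs
        simp only [hu]; gcongr
      calc (s.card : ℝ) * (g₀ * p * a ^ 2 * η ^ 3 / 32 * (n : ℝ) ^ (1 - 3 * γ))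
          = (s.card : ℝ) * (g₀ * h n * (p / 2 * n) / 4) * (a * h n / 2) ^ 2 := by
            rw [e1]; simp only [hh]; ring
        _ ≤ (s.card : ℝ) * s.card * (a * h n / 2) ^ 2 := by gcongr
        _ = _ := by ring
    have hγ3 : 0 < 1 - 3 * γ := by linarith [hγ.2]
    have hsums : ∀ F : (n : ℕ) → ℕ → Finset (Fin (firstSize p n)),
        ∀ᵐ ω ∂P, ∀ᶠ n : ℕ in atTop, ∀ k ≤ firstSize p n, u n ≤ (F n k).card →
          |∑ i ∈ F n k, ε n i ω| < (F n k).card * (a * h n / 2) := by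
      intro F
      -- Small blocks are discarded because the thresholds are too low for them. The finitely many n
      -- with n₁ > n get no blocks, so that the cardinality bound holds for all n.
      let S : (n : ℕ) → Finset (Finset (Fin (firstSize p n))) := fun n =>
        if firstSize p n ≤ n then
          ((Finset.range (firstSize p n + 1)).image (F n)).filter fun s => u n ≤ s.card
        else ∅
      have hS : ∀ n, (S n).card ≤ n + 1 := by
        intro n
        simp only [S]
        split_ifs with hn
        · refine (Finset.card_filter_le _ _).trans (Finset.card_image_le.trans ?_)
          rw [Finset.card_range]; omega
        · simp
      have hS' : ∀ n, ∀ s ∈ S n, u n ≤ s.card := by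
        intro n s hs
        simp only [S] at hs
        split_ifs at hs
        · exact (Finset.mem_filter.1 hs).2
        · simp at hs
      filter_upwards [ae_eventually_partial_sums_lt (P := P) _ S
        (fun n s => (s.card : ℝ) * (a * h n / 2)) (c := g₀ * p * a ^ 2 * η ^ 3 / 32)
        (by positivity) hγ3 hfam hS
        (hthr.mono fun n hn s hs => hn s (hS' n s hs))] with ω hω
      filter_upwards [hω, eventually_firstSize_le hp.1.le hp.2] with n h1 h2 k hk huk
      refine h1 _ ?_
      simp only [S, if_pos h2, Finset.mem_filter]
      exact ⟨Finset.mem_image_of_mem _ (Finset.mem_range_succ_iff.2 hk), huk⟩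
    filter_upwards [hsums fun n k =>
        Finset.univ.filter fun i => d₀ + h n / 2 < x (firstSize p n) i ∧ (i : ℕ) < k,
      hsums fun n k => Finset.univ.filter fun i => x (firstSize p n) i ≤ d₀ - h n / 2 ∧ k ≤ (i : ℕ)]
      with ω hup hlow
    filter_upwards [hup, hlow, hlarge, eventually_half_mul_le_firstSize hp0, eventually_gt_atTop 0,
      hh0.eventually_lt_const (show 0 < min d₀ (1 - d₀) from lt_min hd₀.1 (by linarith [hd₀.2]))]
      with n hup hlow hlarge h3 h4 hsmall
    have hn : (0 : ℝ) < n := by exact_mod_cast h4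
    have hm : (0 : ℝ) < firstSize p n := lt_of_lt_of_le (by positivity) h3
    have hm' : 0 < firstSize p n := by exact_mod_cast hm
    have hhn : 0 < h n := by positivity
    have hs1 := hsmall.trans_le (min_le_left _ _)
    have hs2 := hsmall.trans_le (min_le_right _ _)
    have hd₀' : d₀ ∈ Icc (0 : ℝ) 1 := ⟨hd₀.1.le, hd₀.2.le⟩
    have hcu : ∀ s, 0 ≤ s → s + h n / 2 ≤ 1 → u n ≤ ((Finset.univ.filter fun i =>
        s < x (firstSize p n) i ∧ x (firstSize p n) i ≤ s + h n / 2).card : ℝ) := by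
      intro s hs hs'
      refine le_trans ?_ (hcount _ hm' s (s + h n / 2) hs (by linarith) hs')
      simp only [hu] at hlarge ⊢
      linarith
    rw [abs_le]
    constructor
    · by_contra hcon
      obtain ⟨k, hk, B, hB, hsub, hsum⟩ := exists_le_sum_of_firstEstimate_lt (f := f) (p := p)
        (n := n) (e := fun i => ε n i ω) hx ha.le (fun t ht htd => hslope t ht d₀ hd₀' htd)
        hhn hd₀.2.le (by simp only [hh]; linarith)
      have hc1 := hcu (d₀ - h n) (by linarith) (by linarith)
      rw [show d₀ - h n + h n / 2 = d₀ - h n / 2 by ring] at hc1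
      have hcard : u n ≤ B.card := hc1.trans (by exact_mod_cast Finset.card_le_card hsub)
      have := hlow k hk (by rw [← hB]; exact hcard)
      rw [← hB] at this
      linarith [le_abs_self (∑ i ∈ B, ε n i ω)]
    · by_contra hcon
      obtain ⟨k, hk, B, hB, hsub, hsum⟩ := exists_sum_le_of_lt_firstEstimate (f := f) (p := p)
        (n := n) (e := fun i => ε n i ω) hx ha.le (fun t ht htd => hslope d₀ hd₀' t ht htd)
        hhn (by simp only [hh]; linarith)
      have hc1 := hcu (d₀ + h n / 2) (by linarith [hd₀.1]) (by linarith)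
      rw [add_assoc, add_halves] at hc1
      have hcard : u n ≤ B.card := hc1.trans (by exact_mod_cast Finset.card_le_card hsub)
      have := hup k hk (by rw [← hB]; exact hcard)
      rw [← hB] at this
      linarith [neg_abs_le (∑ i ∈ B, ε n i ω)]
  -- Intersecting over the countably many η = 1/(N + 1) turns the bounds η n^(-γ) into o(n^(-γ)).
  filter_upwards [ae_all_iff.2 hall] with ω hω
  rw [Metric.tendsto_atTop']
  intro δ hδ
  obtain ⟨N, hN⟩ := exists_nat_one_div_lt hδ
  obtain ⟨n₀, hn₀⟩ := eventually_atTop.1 (hω N)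
  refine ⟨n₀, fun n hn => ?_⟩
  have hn0 : (0 : ℝ) < n := by exact_mod_cast (Nat.zero_le n₀).trans_lt hn
  have hpos : 0 < (n : ℝ) ^ γ := Real.rpow_pos_of_pos hn0 γ
  rw [Real.dist_eq, sub_zero, abs_mul, abs_of_pos hpos]
  calc (n : ℝ) ^ γ * |firstEstimate f d₀ p x n (fun i => ε n i ω) - d₀|
      ≤ (n : ℝ) ^ γ * (1 / ((N : ℝ) + 1) * (n : ℝ) ^ (-γ)) := by gcongr; exact hn₀ n hn.le
    _ = 1 / ((N : ℝ) + 1) := by rw [Real.rpow_neg hn0.le]; field_simp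
    _ < δ := hN

end AlmostSure

/-! ## Convergence of powers -/

theorem norm_pow_sub_pow_le {a b : ℂ} (ha : ‖a‖ ≤ 1) (hb : ‖b‖ ≤ 1) (k : ℕ) :
    ‖a ^ k - b ^ k‖ ≤ k * ‖a - b‖ := by
  induction k with
  | zero => simp
  | succ k ih =>
    have h1 : a ^ (k + 1) - b ^ (k + 1) = a ^ k * (a - b) + (a ^ k - b ^ k) * b := by ring
    have h2 : ‖a ^ k‖ ≤ 1 := by rw [norm_pow]; exact pow_le_one₀ (norm_nonneg _) ha
    calc ‖a ^ (k + 1) - b ^ (k + 1)‖ ≤ ‖a ^ k‖ * ‖a - b‖ + ‖a ^ k - b ^ k‖ * ‖b‖ := by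
          rw [h1, ← norm_mul, ← norm_mul]; exact norm_add_le _ _
      _ ≤ 1 * ‖a - b‖ + k * ‖a - b‖ * 1 := by gcongr
      _ = ((k + 1 : ℕ) : ℝ) * ‖a - b‖ := by push_cast; ring

/-- Taylor's formula for |t| ≤ 1; for |t| > 1 the trivial bound 2 + |t| + t²/2 is already below
4|t|³. -/
theorem norm_exp_mul_I_sub_le (t : ℝ) :
    ‖Complex.exp (t * Complex.I) - (1 + t * Complex.I - ((t ^ 2 / 2 : ℝ) : ℂ))‖ ≤ 4 * |t| ^ 3 := by
  have hn : ‖(t : ℂ) * Complex.I‖ = |t| := by simp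
  have hsq : ((t : ℂ) * Complex.I) ^ 2 = -((t ^ 2 : ℝ) : ℂ) := by
    rw [mul_pow, Complex.I_sq]; push_cast; ring
  rcases le_or_gt |t| 1 with h | h
  · have h1 := Complex.exp_bound (x := t * Complex.I) (by rw [hn]; exact h) (n := 3) (by norm_num)
    simp only [Finset.sum_range_succ, Finset.sum_range_zero, hsq, hn] at h1
    have e : Complex.exp (t * Complex.I) - (1 + t * Complex.I - ((t ^ 2 / 2 : ℝ) : ℂ)) =
        Complex.exp (t * Complex.I) - (0 + (t * Complex.I) ^ 0 / (Nat.factorial 0 : ℂ) +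
          (t * Complex.I) ^ 1 / (Nat.factorial 1 : ℂ) +
          -((t ^ 2 : ℝ) : ℂ) / (Nat.factorial 2 : ℂ)) := by
      norm_num [Nat.factorial]
      ring
    rw [e]
    refine h1.trans ?_
    have : 0 ≤ |t| ^ 3 := by positivity
    norm_num [Nat.factorial]
    linarith
  · have h1 : ‖Complex.exp (t * Complex.I)‖ = 1 := Complex.norm_exp_ofReal_mul_I t
    have h2 : ‖(1 : ℂ) + t * Complex.I - ((t ^ 2 / 2 : ℝ) : ℂ)‖ ≤ 1 + |t| + t ^ 2 / 2 := by
      refine (norm_sub_le _ _).trans (add_le_add ((norm_add_le _ _).trans ?_) ?_)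
      · rw [hn, norm_one]
      · rw [Complex.norm_real, Real.norm_of_nonneg (by positivity)]
    refine (norm_sub_le _ _).trans ?_
    rw [h1]
    have h3 : |t| ≤ |t| ^ 3 := le_self_pow₀ h.le (by norm_num)
    have h4 : |t| ^ 2 ≤ |t| ^ 3 := pow_le_pow_right₀ h.le (by norm_num)
    rw [sq_abs] at h4
    linarith

/-- Both `φ` and exp(-q) lie in the unit disc and differ by at most M + q², so their k-th powers
differ by at most k(M + q²). This tends to 0, because k q converges and therefore q → 0. -/
theorem tendsto_pow_of_second_order {k : ℕ → ℕ} {φ : ℕ → ℂ} {q M : ℕ → ℝ} {v : ℝ}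
    (hk : Tendsto k atTop atTop) (hφ : ∀ᶠ n in atTop, ‖φ n‖ ≤ 1) (hq : ∀ᶠ n in atTop, 0 ≤ q n)
    (hφM : ∀ᶠ n in atTop, ‖φ n - ((1 - q n : ℝ) : ℂ)‖ ≤ M n)
    (hv : Tendsto (fun n => k n * q n) atTop (𝓝 v))
    (hM : Tendsto (fun n => k n * M n) atTop (𝓝 0)) :
    Tendsto (fun n => φ n ^ k n) atTop (𝓝 (Complex.exp ((-v : ℝ) : ℂ))) := by
  have hk' : Tendsto (fun n => (k n : ℝ)) atTop atTop := tendsto_natCast_atTop_atTop.comp hk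
  have hq0 : Tendsto q atTop (𝓝 0) := by
    have h1 : Tendsto (fun n => (k n * q n) * (k n : ℝ)⁻¹) atTop (𝓝 (v * 0)) :=
      hv.mul hk'.inv_tendsto_atTop
    rw [mul_zero] at h1
    refine h1.congr' ?_
    filter_upwards [hk'.eventually_gt_atTop 0] with n hn
    field_simp
  have hmain : Tendsto (fun n => Complex.exp ((-(k n * q n) : ℝ) : ℂ)) atTop
      (𝓝 (Complex.exp ((-v : ℝ) : ℂ))) := by
    have hc : Continuous fun z : ℝ => Complex.exp ((-z : ℝ) : ℂ) := by fun_prop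
    exact (hc.tendsto v).comp hv
  have hdiff : Tendsto (fun n => φ n ^ k n - Complex.exp ((-(k n * q n) : ℝ) : ℂ)) atTop (𝓝 0) := by
    have hb : Tendsto (fun n => k n * M n + (k n * q n) * q n) atTop (𝓝 0) := by
      simpa using hM.add (hv.mul hq0)
    refine squeeze_zero_norm' ?_ hb
    filter_upwards [hφ, hq, hφM, hq0.eventually_lt_const one_pos] with n h1 h2 h3 h4
    have e1 : Complex.exp ((-(k n * q n) : ℝ) : ℂ) = ((Real.exp (-q n) : ℝ) : ℂ) ^ k n := by
      rw [Complex.ofReal_exp, ← Complex.exp_nat_mul]; push_cast; ring_nf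
    have h5 : ‖((Real.exp (-q n) : ℝ) : ℂ)‖ ≤ 1 := by
      rw [Complex.norm_real, Real.norm_of_nonneg (Real.exp_pos _).le]
      exact Real.exp_le_one_iff.2 (by linarith)
    have h6 := Real.abs_exp_sub_one_sub_id_le (x := -q n)
      (by rw [abs_neg, abs_of_nonneg h2]; exact h4.le)
    have h7 : ‖((1 - q n : ℝ) : ℂ) - ((Real.exp (-q n) : ℝ) : ℂ)‖ ≤ q n * q n := by
      rw [← Complex.ofReal_sub, Complex.norm_real, Real.norm_eq_abs, abs_sub_comm]
      calc |Real.exp (-q n) - (1 - q n)| = |Real.exp (-q n) - 1 - -q n| := by congr 1; ring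
        _ ≤ (-q n) ^ 2 := h6
        _ = _ := by ring
    rw [e1]
    refine (norm_pow_sub_pow_le h1 h5 _).trans ?_
    have h8 : ‖φ n - ((Real.exp (-q n) : ℝ) : ℂ)‖ ≤ M n + q n * q n := by
      refine (norm_sub_le_norm_sub_add_norm_sub _ (((1 - q n : ℝ) : ℂ)) _).trans
        (add_le_add h3 h7)
    calc (k n : ℝ) * ‖φ n - ((Real.exp (-q n) : ℝ) : ℂ)‖ ≤ k n * (M n + q n * q n) := by gcongr
      _ = _ := by ring
  simpa using hdiff.add hmain

/-! ## Resampling with replacement -/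

section Resampling

variable {k : ℕ}

theorem integral_uniformOn_fin {E : Type*} [NormedAddCommGroup E] [NormedSpace ℝ E]
    [CompleteSpace E]
    (g : Fin k → E) :
    ∫ i, g i ∂(uniformOn (univ : Set (Fin k))) = (k : ℝ)⁻¹ • ∑ i, g i := by
  rcases Nat.eq_zero_or_pos k with rfl | hk
  · simp [Measure.eq_zero_of_isEmpty]
  have : Nonempty (Fin k) := ⟨⟨0, hk⟩⟩
  have : IsProbabilityMeasure (uniformOn (univ : Set (Fin k))) :=
    isProbabilityMeasure_uniformOn finite_univ univ_nonempty
  rw [integral_fintype .of_finite, Finset.smul_sum]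
  refine Finset.sum_congr rfl fun i _ => ?_
  congr 1
  rw [measureReal_def, uniformOn_univ]
  simp

theorem mean_eq_integral (y : Fin k → ℝ) : ∫ i, y i ∂(uniformOn (univ : Set (Fin k))) = mean y := by
  rw [integral_uniformOn_fin, mean, smul_eq_mul, div_eq_inv_mul]

theorem integral_prod_bootstrapMeasure (hk : 0 < k) (g : Fin 2 × Fin k → Fin k → ℂ) :
    ∫ r, ∏ i, g i (r i) ∂(bootstrapMeasure k) =
      ∏ i, ∫ v, g i v ∂(uniformOn (univ : Set (Fin k))) := by
  have : Nonempty (Fin k) := ⟨⟨0, hk⟩⟩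
  have : IsProbabilityMeasure (uniformOn (univ : Set (Fin k))) :=
    isProbabilityMeasure_uniformOn finite_univ univ_nonempty
  exact integral_fintype_prod_eq_prod (f := g)

/-- The characteristic function of a bootstrapped linear statistic. -/
theorem integral_exp_bootstrap (hk : 0 < k) (w : Fin 2 → Fin k → ℝ) (c : ℝ) :
    ∫ r : Resample k, Complex.exp (((c * ∑ j, ∑ i, w j (r (j, i)) : ℝ) : ℂ) * Complex.I)
      ∂(bootstrapMeasure k) =
    ∏ j, (∫ v, Complex.exp (((c * w j v : ℝ) : ℂ) * Complex.I)
      ∂(uniformOn (univ : Set (Fin k)))) ^ k := by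
  have h1 : ∀ r : Resample k, Complex.exp (((c * ∑ j, ∑ i, w j (r (j, i)) : ℝ) : ℂ) * Complex.I) =
      ∏ ji : Fin 2 × Fin k, Complex.exp (((c * w ji.1 (r ji) : ℝ) : ℂ) * Complex.I) := by
    intro r
    rw [← Complex.exp_sum]
    congr 1
    rw [← Finset.sum_mul, ← Complex.ofReal_sum, ← Finset.mul_sum, Fintype.sum_prod_type]
  simp_rw [h1]
  rw [integral_prod_bootstrapMeasure hk
    (fun ji v => Complex.exp (((c * w ji.1 v : ℝ) : ℂ) * Complex.I)), Fintype.prod_prod_type]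
  simp

/-- The second-order expansion averaged over one uniform draw; centring removes the linear term. -/
theorem norm_integral_exp_sub_le (hk : 0 < k) (w : Fin k → ℝ) (hw : ∑ i, w i = 0) (c : ℝ) :
    ‖∫ v, Complex.exp (((c * w v : ℝ) : ℂ) * Complex.I) ∂(uniformOn (univ : Set (Fin k))) -
      ((1 - c ^ 2 / 2 * mean (fun i => w i ^ 2) : ℝ) : ℂ)‖ ≤
      4 * |c| ^ 3 * mean (fun i => |w i| ^ 3) := by
  have hk0 : (k : ℝ) ≠ 0 := by positivity
  rw [integral_uniformOn_fin]
  have e1 : (((1 - c ^ 2 / 2 * mean (fun i => w i ^ 2) : ℝ)) : ℂ) =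
      (k : ℝ)⁻¹ • ∑ i, (1 + ((c * w i : ℝ) : ℂ) * Complex.I - (((c * w i) ^ 2 / 2 : ℝ) : ℂ)) := by
    rw [Finset.sum_sub_distrib, Finset.sum_add_distrib, ← Finset.sum_mul, ← Complex.ofReal_sum,
      ← Complex.ofReal_sum, ← Finset.mul_sum, hw]
    simp only [mean, mul_pow, ← Finset.sum_div, ← Finset.mul_sum, Finset.sum_const,
      Finset.card_univ, Fintype.card_fin, nsmul_eq_mul, mul_one, mul_zero, Complex.ofReal_zero,
      zero_mul, add_zero, Complex.real_smul]
    push_cast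
    have : (k : ℂ) ≠ 0 := by exact_mod_cast hk.ne'
    field_simp
  rw [e1, ← smul_sub, ← Finset.sum_sub_distrib, norm_smul, Real.norm_of_nonneg (by positivity)]
  have h2 : ‖∑ i, (Complex.exp (((c * w i : ℝ) : ℂ) * Complex.I) -
      (1 + ((c * w i : ℝ) : ℂ) * Complex.I - (((c * w i) ^ 2 / 2 : ℝ) : ℂ)))‖ ≤
      ∑ i, 4 * |c * w i| ^ 3 :=
    (norm_sum_le _ _).trans (Finset.sum_le_sum fun i _ => norm_exp_mul_I_sub_le _)
  calc _ ≤ (k : ℝ)⁻¹ * ∑ i, 4 * |c * w i| ^ 3 := by gcongr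
    _ = _ := by
      simp only [mean, abs_mul, mul_pow]
      rw [← Finset.mul_sum, ← Finset.mul_sum]
      ring

/-- Chebyshev's inequality for a bootstrapped sum. -/
theorem bootstrapMeasure_real_abs_sum_ge_le (hk : 0 < k) (w : Fin k → ℝ) (hw : ∑ i, w i = 0)
    (j : Fin 2) {τ : ℝ} (hτ : 0 < τ) :
    (bootstrapMeasure k).real {r | τ ≤ |∑ i, w (r (j, i))|} ≤
      k * mean (fun i => w i ^ 2) / τ ^ 2 := by
  have : Nonempty (Fin k) := ⟨⟨0, hk⟩⟩
  have hprob : IsProbabilityMeasure (uniformOn (univ : Set (Fin k))) :=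
    isProbabilityMeasure_uniformOn finite_univ univ_nonempty
  have hind : iIndepFun (fun (ji : Fin 2 × Fin k) (r : Resample k) => w (r ji))
      (bootstrapMeasure k) :=
    iIndepFun_pi (X := fun _ v => w v) fun _ => (measurable_of_finite w).aemeasurable
  have hmp : ∀ ji : Fin 2 × Fin k, MeasurePreserving (fun r : Resample k => r ji)
      (bootstrapMeasure k) (uniformOn (univ : Set (Fin k))) := fun ji =>
    measurePreserving_eval (fun _ => uniformOn (univ : Set (Fin k))) ji
  have hint : ∀ (ji : Fin 2 × Fin k) (g : Fin k → ℝ),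
      ∫ r : Resample k, g (r ji) ∂(bootstrapMeasure k) = mean g := by
    intro ji g
    rw [← mean_eq_integral, ← (hmp ji).map_eq, integral_map (hmp ji).measurable.aemeasurable
      (measurable_of_finite g).aestronglyMeasurable]
  have hmem : ∀ i : Fin k, MemLp (fun r : Resample k => w (r (j, i))) 2 (bootstrapMeasure k) :=
    fun i => MemLp.of_discrete
  have hw0 : mean w = 0 := by rw [mean, hw, zero_div]
  have hvar : variance (fun r : Resample k => ∑ i, w (r (j, i))) (bootstrapMeasure k) =
      k * mean (fun i => w i ^ 2) := by
    have h1 := IndepFun.variance_sum (μ := bootstrapMeasure k)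
      (X := fun (i : Fin k) (r : Resample k) => w (r (j, i))) (s := Finset.univ)
      (fun i _ => hmem i) fun a _ b _ hab =>
        hind.indepFun (i := (j, a)) (j := (j, b)) (by simpa using hab)
    have h2 : ∀ i : Fin k, variance (fun r : Resample k => w (r (j, i))) (bootstrapMeasure k) =
        mean (fun i => w i ^ 2) := by
      intro i
      rw [variance_eq_sub (hmem i), hint (j, i) w, hw0]
      simpa using hint (j, i) fun v => w v ^ 2
    simp only [h2, Finset.sum_const, Finset.card_univ, Fintype.card_fin, nsmul_eq_mul] at h1
    rw [← h1]
    congr 1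
    ext r
    simp
  have hmean : ∫ r : Resample k, ∑ i, w (r (j, i)) ∂(bootstrapMeasure k) = 0 := by
    rw [integral_finsetSum _ fun i _ => (hmem i).integrable (by norm_num)]
    simp [hint _ w, hw0]
  have h3 := meas_ge_le_variance_div_sq (μ := bootstrapMeasure k)
    (X := fun r : Resample k => ∑ i, w (r (j, i))) MemLp.of_discrete hτ
  rw [hmean, hvar] at h3
  simp only [sub_zero] at h3
  rw [measureReal_def]
  refine ENNReal.toReal_le_of_le_ofReal ?_ h3
  have : 0 ≤ mean (fun i => w i ^ 2) := by unfold mean; positivity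
  positivity

end Resampling

/-! ## Pólya's theorem -/

/-- On a compact interval, monotonicity squeezes `G n` between its values at neighbouring points
where `F` varies little. Beyond the end points, both functions are within ε of 0 or of 1. -/
theorem eventually_forall_abs_sub_le {F : ℝ → ℝ} {G : ℕ → ℝ → ℝ} (hF : Monotone F)
    (hFc : Continuous F) (hF0 : Tendsto F atBot (𝓝 0)) (hF1 : Tendsto F atTop (𝓝 1))
    (hG : ∀ n, Monotone (G n)) (hG01 : ∀ n t, G n t ∈ Icc (0 : ℝ) 1)
    (h : ∀ t, Tendsto (fun n => G n t) atTop (𝓝 (F t))) {ε : ℝ} (hε : 0 < ε) :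
    ∀ᶠ n in atTop, ∀ t, |G n t - F t| ≤ ε := by
  have hF01 : ∀ t, F t ∈ Icc (0 : ℝ) 1 := fun t => ⟨hF.le_of_tendsto hF0 t, hF.ge_of_tendsto hF1 t⟩
  have hclose : ∀ t, ∀ δ > 0, ∀ᶠ n in atTop, |G n t - F t| < δ := fun t δ hδ => by
    simpa [Real.dist_eq] using (Metric.tendsto_nhds.1 (h t)) δ hδ
  obtain ⟨a, ha⟩ := (hF0.eventually_lt_const (half_pos hε)).exists
  obtain ⟨b, hb⟩ := (hF1.eventually_const_lt (show 1 - ε / 2 < 1 by linarith)).exists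
  have hloc : TendstoUniformlyOn G F atTop (Icc a b) := by
    rw [← tendstoLocallyUniformlyOn_iff_tendstoUniformlyOn_of_compact isCompact_Icc]
    rw [Metric.tendstoLocallyUniformlyOn_iff]
    intro δ hδ t _
    have hcont := Metric.continuous_iff.1 hFc t (δ / 4) (by linarith)
    obtain ⟨r, hr, hr'⟩ := hcont
    have e1 := hr' (t - r / 2) (by rw [Real.dist_eq, abs_lt]; constructor <;> linarith)
    have e2 := hr' (t + r / 2) (by rw [Real.dist_eq, abs_lt]; constructor <;> linarith)
    rw [Real.dist_eq, abs_lt] at e1 e2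
    refine ⟨Ioo (t - r / 2) (t + r / 2),
      mem_nhdsWithin_of_mem_nhds (Ioo_mem_nhds (by linarith) (by linarith)), ?_⟩
    filter_upwards [hclose (t - r / 2) (δ / 4) (by linarith),
      hclose (t + r / 2) (δ / 4) (by linarith)] with n h1 h2 s hs
    rw [abs_lt] at h1 h2
    have g1 := hG n hs.1.le
    have g2 := hG n hs.2.le
    have f1 := hF hs.1.le
    have f2 := hF hs.2.le
    rw [Real.dist_eq, abs_lt]
    constructor <;> linarith
  have hunif := Metric.tendstoUniformlyOn_iff.1 hloc ε hε
  filter_upwards [hunif, hclose a (ε / 2) (half_pos hε), hclose b (ε / 2) (half_pos hε)]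
    with n h1 h2 h3 t
  rw [abs_lt] at h2 h3
  rcases lt_or_ge t a with hta | hta
  · have := hG n hta.le
    have := hF hta.le
    have := (hG01 n t).1
    have := (hF01 t).1
    rw [abs_le]; constructor <;> linarith
  rcases lt_or_ge b t with htb | htb
  · have := hG n htb.le
    have := hF htb.le
    have := (hG01 n t).2
    have := (hF01 t).2
    rw [abs_le]; constructor <;> linarith
  · have := h1 t ⟨hta, htb⟩
    rw [dist_comm, Real.dist_eq] at this
    exact this.le

/-- **Pólya's theorem**: convergence in distribution to a law without atoms implies uniform
convergence of the distribution functions. -/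
theorem tendsto_iSup_abs_sub_of_tendstoInDistribution {Ω : ℕ → Type*} {Ω' : Type*}
    [∀ n, MeasurableSpace (Ω n)] [MeasurableSpace Ω'] {P : (n : ℕ) → Measure (Ω n)}
    [∀ n, IsProbabilityMeasure (P n)] {Q : Measure Ω'} [IsProbabilityMeasure Q]
    {X : (n : ℕ) → Ω n → ℝ} {Z : Ω' → ℝ} (h : TendstoInDistribution X atTop Z P Q)
    (hZ : ∀ t, Q.map Z {t} = 0) :
    Tendsto (fun n => ⨆ t : ℝ, |(P n).real {ω | X n ω ≤ t} - Q.real {ω | Z ω ≤ t}|)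
      atTop (𝓝 0) := by
  have hX := h.forall_aemeasurable
  have hZm := h.aemeasurable_limit
  have hmapP : ∀ n, IsProbabilityMeasure ((P n).map (X n)) :=
    fun n => Measure.isProbabilityMeasure_map (hX n)
  have hmapQ : IsProbabilityMeasure (Q.map Z) := Measure.isProbabilityMeasure_map hZm
  have hXe : ∀ n t, (P n).real {ω | X n ω ≤ t} = cdf ((P n).map (X n)) t := fun n t => by
    rw [cdf_eq_real, map_measureReal_apply_of_aemeasurable (hX n) measurableSet_Iic]; rfl
  have hZe : ∀ t, Q.real {ω | Z ω ≤ t} = cdf (Q.map Z) t := fun t => by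
    rw [cdf_eq_real, map_measureReal_apply_of_aemeasurable hZm measurableSet_Iic]; rfl
  simp only [hXe, hZe]
  have hlim : ∀ t, Tendsto (fun n => cdf ((P n).map (X n)) t) atTop (𝓝 (cdf (Q.map Z) t)) := by
    intro t
    simp only [cdf_eq_real, measureReal_def]
    have h1 := ProbabilityMeasure.tendsto_measure_of_null_frontier_of_tendsto' h.tendsto
      (E := Iic t) (by
        rw [frontier_Iic]
        exact hZ t)
    exact (ENNReal.tendsto_toReal (measure_ne_top _ _)).comp h1
  have hcont : Continuous (cdf (Q.map Z)) := by
    rw [continuous_iff_continuousAt]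
    intro t
    have h1 : (cdf (Q.map Z)).measure {t} = 0 := by rw [measure_cdf]; exact hZ t
    rw [StieltjesFunction.measure_singleton, ENNReal.ofReal_eq_zero] at h1
    have h2 : Function.leftLim (cdf (Q.map Z)) t = cdf (Q.map Z) t :=
      le_antisymm ((monotone_cdf _).leftLim_le le_rfl) (by linarith)
    exact (monotone_cdf (Q.map Z)).continuousAt_iff_leftLim_eq_rightLim.2
      (by rw [h2, StieltjesFunction.rightLim_eq])
  rw [Metric.tendsto_atTop']
  intro ε hε
  obtain ⟨N, hN⟩ := eventually_atTop.1 (eventually_forall_abs_sub_le (monotone_cdf _) hcont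
    (tendsto_cdf_atBot _) (tendsto_cdf_atTop _) (fun n => monotone_cdf ((P n).map (X n)))
    (fun n t => ⟨cdf_nonneg _ t, cdf_le_one _ t⟩) hlim (half_pos hε))
  refine ⟨N, fun n hn => ?_⟩
  rw [Real.dist_eq, sub_zero, abs_of_nonneg (Real.iSup_nonneg fun t => abs_nonneg _)]
  exact (ciSup_le fun t => hN n hn.le t).trans_lt (half_lt_self hε)

/-! ## Characteristic functions -/

theorem norm_exp_mul_I_sub_exp_le (x y : ℝ) :
    ‖Complex.exp (x * Complex.I) - Complex.exp (y * Complex.I)‖ ≤ |x - y| := by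
  have h1 : Complex.exp (x * Complex.I) - Complex.exp (y * Complex.I) =
      Complex.exp (y * Complex.I) * (Complex.exp (Complex.I * (x - y : ℝ)) - 1) := by
    rw [mul_sub, mul_one, ← Complex.exp_add]
    congr 2
    push_cast
    ring
  rw [h1, norm_mul, Complex.norm_exp_ofReal_mul_I, one_mul]
  exact Real.norm_exp_I_mul_ofReal_sub_one_le

/-- Random variables whose difference converges to `0` in probability have the same limiting
characteristic functions. -/
theorem tendsto_integral_exp_of_close {Ω : ℕ → Type*} [∀ n, MeasurableSpace (Ω n)]
    {P : (n : ℕ) → Measure (Ω n)} [∀ n, IsProbabilityMeasure (P n)] {X T : (n : ℕ) → Ω n → ℝ}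
    (hX : ∀ n, Measurable (X n)) (hT : ∀ n, Measurable (T n))
    (h : ∀ ε > 0, ∀ᶠ n in atTop, (P n).real {ω | ε < |X n ω - T n ω|} ≤ ε) {s : ℝ} {z : ℂ}
    (hz : Tendsto (fun n => ∫ ω, Complex.exp (((s * T n ω : ℝ) : ℂ) * Complex.I) ∂(P n))
      atTop (𝓝 z)) :
    Tendsto (fun n => ∫ ω, Complex.exp (((s * X n ω : ℝ) : ℂ) * Complex.I) ∂(P n))
      atTop (𝓝 z) := by
  have hint : ∀ (n) (Y : Ω n → ℝ), Measurable Y →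
      Integrable (fun ω => Complex.exp (((s * Y ω : ℝ) : ℂ) * Complex.I)) (P n) := by
    intro n Y hY
    refine Integrable.of_bound (C := 1) (by fun_prop) (ae_of_all _ fun ω => ?_)
    rw [Complex.norm_exp_ofReal_mul_I]
  have hbound : ∀ ε > 0, ∀ᶠ n in atTop,
      ‖∫ ω, Complex.exp (((s * X n ω : ℝ) : ℂ) * Complex.I) ∂(P n) -
        ∫ ω, Complex.exp (((s * T n ω : ℝ) : ℂ) * Complex.I) ∂(P n)‖ ≤ (|s| + 2) * ε := by
    intro ε hε
    filter_upwards [h ε hε] with n hn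
    have hmeas : MeasurableSet {ω | ε < |X n ω - T n ω|} := by
      have := (hX n).sub (hT n)
      exact measurableSet_lt measurable_const (by fun_prop)
    rw [← integral_sub (hint n _ (hX n)) (hint n _ (hT n))]
    have hI : Integrable ({ω | ε < |X n ω - T n ω|}.indicator fun _ => (2 : ℝ)) (P n) :=
      (integrable_const _).indicator hmeas
    calc _ ≤ ∫ ω, (|s| * ε + {ω | ε < |X n ω - T n ω|}.indicator (fun _ => (2 : ℝ)) ω) ∂(P n) := by
          refine norm_integral_le_of_norm_le ((integrable_const _).add hI) (ae_of_all _ fun ω => ?_)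
          by_cases hω : ε < |X n ω - T n ω|
          · rw [indicator_of_mem (show ω ∈ {ω | ε < |X n ω - T n ω|} from hω)]
            refine (norm_sub_le _ _).trans ?_
            rw [Complex.norm_exp_ofReal_mul_I, Complex.norm_exp_ofReal_mul_I]
            have : 0 ≤ |s| * ε := by positivity
            linarith
          · rw [indicator_of_notMem (show ω ∉ {ω | ε < |X n ω - T n ω|} from hω), add_zero]
            refine (norm_exp_mul_I_sub_exp_le _ _).trans ?_
            rw [← mul_sub, abs_mul]
            exact mul_le_mul_of_nonneg_left (not_lt.1 hω) (abs_nonneg _)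
      _ = |s| * ε + (P n).real {ω | ε < |X n ω - T n ω|} * 2 := by
          rw [integral_add (integrable_const _) hI, integral_indicator_const _ hmeas]
          simp
      _ ≤ (|s| + 2) * ε := by linarith
  have hdiff : Tendsto (fun n => ∫ ω, Complex.exp (((s * X n ω : ℝ) : ℂ) * Complex.I) ∂(P n) -
        ∫ ω, Complex.exp (((s * T n ω : ℝ) : ℂ) * Complex.I) ∂(P n)) atTop (𝓝 0) := by
    rw [Metric.tendsto_nhds]
    intro δ hδ
    filter_upwards [hbound (δ / (2 * (|s| + 2))) (by positivity)] with n hn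
    rw [dist_zero_right]
    refine hn.trans_lt ?_
    have : (|s| + 2) * (δ / (2 * (|s| + 2))) = δ / 2 := by field_simp
    rw [this]
    exact half_lt_self hδ
  simpa using hdiff.add hz

/-- Central limit theorem for the bootstrapped sums, in terms of characteristic functions. -/
theorem tendsto_integral_exp_bootstrap {k : ℕ → ℕ} (hk : Tendsto k atTop atTop)
    {w : (n : ℕ) → Fin 2 → Fin (k n) → ℝ} (hw : ∀ n j, ∑ i, w n j i = 0) {c : ℕ → ℝ} {ρ v B : ℝ}
    (hc : Tendsto c atTop (𝓝 0)) (hkc : Tendsto (fun n => k n * c n ^ 2) atTop (𝓝 ρ))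
    (hv : ∀ j, Tendsto (fun n => mean fun i => w n j i ^ 2) atTop (𝓝 v))
    (hB : ∀ j, ∀ᶠ n in atTop, mean (fun i => |w n j i| ^ 3) ≤ B) :
    Tendsto (fun n => ∫ r : Resample (k n),
      Complex.exp (((c n * ∑ j, ∑ i, w n j (r (j, i)) : ℝ) : ℂ) * Complex.I)
        ∂(bootstrapMeasure (k n))) atTop (𝓝 (Complex.exp ((-(ρ * v) : ℝ) : ℂ))) := by
  have hfac : ∀ j, Tendsto (fun n => (∫ v, Complex.exp (((c n * w n j v : ℝ) : ℂ) * Complex.I)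
      ∂(uniformOn (univ : Set (Fin (k n))))) ^ k n) atTop
      (𝓝 (Complex.exp ((-(ρ * v / 2) : ℝ) : ℂ))) := by
    intro j
    refine tendsto_pow_of_second_order (q := fun n => c n ^ 2 / 2 * mean fun i => w n j i ^ 2)
      (M := fun n => 4 * |c n| ^ 3 * mean fun i => |w n j i| ^ 3) hk ?_ ?_ ?_ ?_ ?_
    · filter_upwards [hk.eventually_gt_atTop 0] with n hn
      have : Nonempty (Fin (k n)) := ⟨⟨0, hn⟩⟩
      have : IsProbabilityMeasure (uniformOn (univ : Set (Fin (k n)))) :=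
        isProbabilityMeasure_uniformOn finite_univ univ_nonempty
      refine (norm_integral_le_of_norm_le_const (C := 1) (ae_of_all _ fun i => ?_)).trans ?_
      · rw [Complex.norm_exp_ofReal_mul_I]
      · simp
    · refine Eventually.of_forall fun n => ?_
      unfold mean
      positivity
    · filter_upwards [hk.eventually_gt_atTop 0] with n hn
      exact norm_integral_exp_sub_le hn _ (hw n j) _
    · have := (hkc.mul (hv j)).div_const 2
      refine this.congr fun n => ?_
      ring
    -- Lyapunov's condition: k|c|³ is the bounded k c² times |c| → 0.
    · have h1 : Tendsto (fun n => 4 * (k n * c n ^ 2) * (|c n| * B)) atTop (𝓝 0) := by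
        have := (hkc.const_mul 4).mul (hc.abs.mul_const B)
        simpa using this
      refine squeeze_zero' (Eventually.of_forall fun n => ?_) ?_ h1
      · unfold mean
        positivity
      · filter_upwards [hB j] with n hn
        calc (k n : ℝ) * (4 * |c n| ^ 3 * mean fun i => |w n j i| ^ 3)
            ≤ k n * (4 * |c n| ^ 3 * B) := by gcongr
          _ = 4 * (k n * |c n| ^ 2) * (|c n| * B) := by ring
          _ = _ := by rw [sq_abs]
  have hprod := tendsto_finsetProd (Finset.univ : Finset (Fin 2)) fun j _ => hfac j
  have e1 : ∏ _j : Fin 2, Complex.exp ((-(ρ * v / 2) : ℝ) : ℂ) =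
      Complex.exp ((-(ρ * v) : ℝ) : ℂ) := by
    rw [Fin.prod_univ_two, ← Complex.exp_add]
    congr 1
    push_cast
    ring
  rw [e1] at hprod
  refine hprod.congr' ?_
  filter_upwards [hk.eventually_gt_atTop 0] with n hn
  exact (integral_exp_bootstrap hn (w n) (c n)).symm

/-! ## Difference quotients -/

/-- Differentiability at `d` suffices even when the points `u` are random: u - d = O(δ), so the
remainder o(u - d) is o(δ). -/
theorem tendsto_sub_div_of_hasDerivAt {f : ℝ → ℝ} {b d c : ℝ} (hf : HasDerivAt f b d)
    {u δ : ℕ → ℝ} (hδ : Tendsto δ atTop (𝓝 0)) (hδ0 : ∀ᶠ n in atTop, δ n ≠ 0)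
    (hu : Tendsto (fun n => (u n - d) / δ n) atTop (𝓝 c)) :
    Tendsto (fun n => (f (u n) - f d) / δ n) atTop (𝓝 (b * c)) := by
  have hud : Tendsto u atTop (𝓝 d) := by
    have h1 := (hu.mul hδ).add_const d
    rw [mul_zero, zero_add] at h1
    refine h1.congr' ?_
    filter_upwards [hδ0] with n hn
    field_simp
    ring
  have hO : (fun n => u n - d) =O[atTop] δ :=
    Asymptotics.isBigO_of_div_tendsto_nhds (hδ0.mono fun n hn h => absurd h hn) c hu
  have ho := (hf.isLittleO.comp_tendsto hud).trans_isBigO hO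
  have h2 := ho.tendsto_div_nhds_zero.add (hu.const_mul b)
  rw [zero_add] at h2
  refine h2.congr fun n => ?_
  simp only [Function.comp_apply, smul_eq_mul]
  ring

/-! ## Averages -/

section Mean

variable {k : ℕ}

theorem mean_const_add (hk : 0 < k) (c : ℝ) (y : Fin k → ℝ) :
    mean (fun i => c + y i) = c + mean y := by
  have : (k : ℝ) ≠ 0 := by positivity
  simp only [mean, Finset.sum_add_distrib, Finset.sum_const, Finset.card_univ, Fintype.card_fin,
    nsmul_eq_mul]
  field_simp

theorem sum_sub_mean (y : Fin k → ℝ) : ∑ i, (y i - mean y) = 0 := by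
  rcases Nat.eq_zero_or_pos k with rfl | hk
  · simp
  have : (k : ℝ) ≠ 0 := by positivity
  simp only [mean, Finset.sum_sub_distrib, Finset.sum_const, Finset.card_univ, Fintype.card_fin,
    nsmul_eq_mul]
  field_simp
  ring

theorem mean_sub_mean_sq (hk : 0 < k) (y : Fin k → ℝ) :
    mean (fun i => (y i - mean y) ^ 2) = mean (fun i => y i ^ 2) - mean y ^ 2 := by
  have hk' : (k : ℝ) ≠ 0 := by positivity
  have h1 : ∑ i, y i = k * mean y := by unfold mean; field_simp
  have h2 : ∑ i, (y i - mean y) ^ 2 = ∑ i, y i ^ 2 - k * mean y ^ 2 := by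
    have : ∀ i, (y i - mean y) ^ 2 = y i ^ 2 - 2 * mean y * y i + mean y ^ 2 := fun i => by ring
    simp only [this, Finset.sum_add_distrib, Finset.sum_sub_distrib, ← Finset.mul_sum, h1,
      Finset.sum_const, Finset.card_univ, Fintype.card_fin, nsmul_eq_mul]
    ring
  rw [show mean (fun i => (y i - mean y) ^ 2) = (∑ i, (y i - mean y) ^ 2) / k from rfl, h2, sub_div,
    mul_div_cancel_left₀ _ hk']
  rfl

theorem mean_abs_sub_mean_cube_le (hk : 0 < k) (y : Fin k → ℝ) :
    mean (fun i => |y i - mean y| ^ 3) ≤ 4 * (|mean y| ^ 3 + mean fun i => |y i| ^ 3) := by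
  rw [← mean_const_add hk]
  unfold mean
  rw [← mul_div_assoc, Finset.mul_sum]
  refine div_le_div_of_nonneg_right (Finset.sum_le_sum fun i _ => ?_) (Nat.cast_nonneg _)
  refine (pow_le_pow_left₀ (abs_nonneg _) (abs_sub _ _) 3).trans ?_
  refine (add_pow_le (abs_nonneg _) (abs_nonneg _) 3).trans ?_
  norm_num
  linarith

/-- The line passes through the midpoint of the two mean points. In this form the abscissa (L + U)/2
cancels between the bootstrap estimate and the original one. -/
theorem lsInverse_eq {θ L U : ℝ} {y z : Fin k → ℝ} (h : lsSlope L U y z ≠ 0) :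
    lsInverse θ L U y z = (L + U) / 2 + (θ - (mean y + mean z) / 2) / lsSlope L U y z := by
  unfold lsInverse lsIntercept
  field_simp
  ring

end Mean

/-! ## Linearization of the bootstrapped root -/

/-- Deterministic core of the linearization. `β` and `β'` are the slopes before and after
resampling, `A` and `B` the shifts of the response means at L and U, `W` is θ₀ minus the height of
the line at the midpoint, and `s` is √n. -/
theorem abs_root_sub_linear_le {b β β' W A B δ s M : ℝ} (hb : 0 < b) (hδ : 0 < δ) (hs : 0 < s)
    (hβ : |β - b| ≤ b / 4) (hβ' : β' = β + (B - A) / (2 * δ)) (hA : s * |A| ≤ M)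
    (hB : s * |B| ≤ M) (hM : M / (s * δ) ≤ b / 4) :
    β ≠ 0 ∧ β' ≠ 0 ∧
      |s * ((W - (A + B) / 2) / β' - W / β) - -s * (A + B) / (2 * b)| ≤
        4 / b ^ 2 * (|W| / δ * M + M * (M / (s * δ) + |β - b|)) := by
  have hM0 : 0 ≤ M := (by positivity : 0 ≤ s * |A|).trans hA
  have hBA : s * |B - A| ≤ 2 * M := by
    have := mul_le_mul_of_nonneg_left (abs_sub B A) hs.le
    linarith
  have hΔ : |β' - β| = |B - A| / (2 * δ) := by
    rw [hβ', add_sub_cancel_left, abs_div, abs_of_pos (show 0 < 2 * δ by positivity)]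
  have hsΔ : s * |β' - β| ≤ M / δ := by
    rw [hΔ, ← mul_div_assoc, div_le_div_iff₀ (by positivity) hδ]
    nlinarith
  have hΔ' : |β' - β| ≤ M / (s * δ) := by
    rw [← div_div, div_right_comm, le_div_iff₀ hs]; linarith
  have h1 := abs_le.1 hβ
  have h2 := abs_le.1 (hΔ'.trans hM)
  have hβ0 : b / 2 ≤ β := by linarith
  have hβ'0 : b / 2 ≤ β' := by linarith
  have hβpos : 0 < β := by linarith
  have hβ'pos : 0 < β' := by linarith
  refine ⟨hβpos.ne', hβ'pos.ne', ?_⟩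
  -- The first error comes from the change of slope and is of order (|W|/δ)M; the second comes from
  -- replacing β' by b. Both slopes are at least b/2, whence the factor 4/b².
  have key : s * ((W - (A + B) / 2) / β' - W / β) - -s * (A + B) / (2 * b) =
      W * (s * (β - β')) * (1 / (β * β')) + s * ((A + B) / 2) * (β' - b) * (1 / (b * β')) := by
    field_simp
    ring
  have hr1 : 1 / (β * β') ≤ 4 / b ^ 2 := by
    rw [div_le_div_iff₀ (by positivity) (by positivity)]
    nlinarith
  have hr2 : 1 / (b * β') ≤ 4 / b ^ 2 := by
    rw [div_le_div_iff₀ (by positivity) (by positivity)]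
    nlinarith
  have hAB : |s * ((A + B) / 2)| ≤ M := by
    rw [abs_mul, abs_of_pos hs, abs_div, abs_two]
    have := mul_le_mul_of_nonneg_left (abs_add_le A B) hs.le
    linarith
  have hβb : |β' - b| ≤ M / (s * δ) + |β - b| :=
    (abs_sub_le β' β b).trans (add_le_add_left hΔ' _)
  rw [key]
  refine (abs_add_le _ _).trans ?_
  rw [mul_add]
  refine add_le_add ?_ ?_
  · rw [abs_mul, abs_mul, abs_mul, abs_of_pos hs, abs_sub_comm β β',
      abs_of_pos (show 0 < 1 / (β * β') by positivity)]
    calc |W| * (s * |β' - β|) * (1 / (β * β')) ≤ |W| * (M / δ) * (4 / b ^ 2) := by gcongr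
      _ = _ := by ring
  · rw [abs_mul, abs_mul, abs_of_pos (show 0 < 1 / (b * β') by positivity)]
    calc |s * ((A + B) / 2)| * |β' - b| * (1 / (b * β'))
        ≤ M * (M / (s * δ) + |β - b|) * (4 / b ^ 2) := by gcongr
      _ = _ := by ring

/-! ## The bootstrap for given data -/

section GivenData

variable {f : ℝ → ℝ} {d₀ p K γ σ b κ : ℝ} {x : (m : ℕ) → Fin m → ℝ} {e : ℕ → ℕ → ℝ}
  {E : Fin 2 → ℕ → ℕ → ℝ}

/-- Since n₁ ≤ n, the half-width is at least K n^(-γ); thus o(n^(-γ)) implies o(δ). -/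
theorem eventually_le_rpow_mul_halfWidth (hp : p ∈ Ioo (0 : ℝ) 1) (hK : 0 < K) (hγ : 0 < γ) :
    ∀ᶠ n : ℕ in atTop, 0 < K * (firstSize p n : ℝ) ^ (-γ) ∧
      K ≤ (n : ℝ) ^ γ * (K * (firstSize p n : ℝ) ^ (-γ)) := by
  filter_upwards [eventually_half_mul_le_firstSize hp.1, eventually_firstSize_le hp.1.le hp.2,
    eventually_gt_atTop 0] with n h1 h2 h3
  have hp0 := hp.1
  have hn : (0 : ℝ) < n := by exact_mod_cast h3
  have hm : (0 : ℝ) < firstSize p n := lt_of_lt_of_le (by positivity) h1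
  refine ⟨by positivity, ?_⟩
  have h4 : (firstSize p n : ℝ) ^ γ ≤ (n : ℝ) ^ γ :=
    Real.rpow_le_rpow hm.le (by exact_mod_cast h2) hγ.le
  have h5 : 0 < (firstSize p n : ℝ) ^ γ := by positivity
  rw [Real.rpow_neg hm.le, mul_left_comm]
  refine le_mul_of_one_le_right hK.le ?_
  rw [← div_eq_mul_inv]
  exact (one_le_div h5).2 h4

theorem tendsto_halfWidth (hp : p ∈ Ioo (0 : ℝ) 1) (hγ : 0 < γ) :
    Tendsto (fun n => K * (firstSize p n : ℝ) ^ (-γ)) atTop (𝓝 0) := by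
  have h1 : Tendsto (fun n : ℕ => (firstSize p n : ℝ)) atTop atTop := by
    refine tendsto_atTop_mono' _ (eventually_half_mul_le_firstSize hp.1) ?_
    exact tendsto_natCast_atTop_atTop.const_mul_atTop (by linarith [hp.1])
  simpa using ((tendsto_rpow_neg_atTop hγ).comp h1).const_mul K

theorem tendsto_div_halfWidth (hp : p ∈ Ioo (0 : ℝ) 1) (hK : 0 < K) (hγ : 0 < γ) {a : ℕ → ℝ}
    (ha : Tendsto (fun n : ℕ => (n : ℝ) ^ γ * a n) atTop (𝓝 0)) :
    Tendsto (fun n => a n / (K * (firstSize p n : ℝ) ^ (-γ))) atTop (𝓝 0) := by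
  have h1 := (ha.abs).div_const K
  rw [abs_zero, zero_div] at h1
  refine squeeze_zero_norm' ?_ h1
  filter_upwards [eventually_le_rpow_mul_halfWidth hp hK hγ] with n hn
  rw [Real.norm_eq_abs, abs_div, abs_of_pos hn.1, div_le_div_iff₀ hn.1 hK, abs_mul,
    abs_of_nonneg (show 0 ≤ (n : ℝ) ^ γ by positivity)]
  calc |a n| * K ≤ |a n| * ((n : ℝ) ^ γ * (K * (firstSize p n : ℝ) ^ (-γ))) := by
        gcongr; exact hn.2
    _ = _ := by ring

theorem tendsto_sqrt_mul_halfWidth (hp : p ∈ Ioo (0 : ℝ) 1) (hK : 0 < K)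
    (hγ : γ ∈ Ioo (0 : ℝ) (1 / 3)) :
    Tendsto (fun n : ℕ => √n * (K * (firstSize p n : ℝ) ^ (-γ))) atTop atTop := by
  have h1 : Tendsto (fun n : ℕ => (n : ℝ) ^ (1 / 2 - γ) * K) atTop atTop :=
    ((tendsto_rpow_atTop (by linarith [hγ.2])).comp tendsto_natCast_atTop_atTop).atTop_mul_const hK
  refine tendsto_atTop_mono' _ ?_ h1
  filter_upwards [eventually_le_rpow_mul_halfWidth hp hK hγ.1, eventually_gt_atTop 0] with n hn h0
  have hn0 : (0 : ℝ) < n := by exact_mod_cast h0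
  calc (n : ℝ) ^ (1 / 2 - γ) * K
      ≤ (n : ℝ) ^ (1 / 2 - γ) * ((n : ℝ) ^ γ * (K * (firstSize p n : ℝ) ^ (-γ))) := by
        gcongr; exact hn.2
    _ = (n : ℝ) ^ (1 / 2 - γ + γ) * (K * (firstSize p n : ℝ) ^ (-γ)) := by
        rw [Real.rpow_add hn0]; ring
    _ = _ := by rw [sub_add_cancel, Real.sqrt_eq_rpow]

theorem tendsto_secondSize (hp : p ∈ Ioo (0 : ℝ) 1) :
    Tendsto (fun n => secondSize p n) atTop atTop := by
  rw [← tendsto_natCast_atTop_iff (R := ℝ)]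
  refine tendsto_atTop_mono' _ (eventually_mul_le_secondSize hp.1 hp.2) ?_
  exact tendsto_natCast_atTop_atTop.const_mul_atTop (by linarith [hp.2])

theorem tendsto_div_secondSize (hp : p ∈ Ioo (0 : ℝ) 1) :
    Tendsto (fun n : ℕ => (n : ℝ) / secondSize p n) atTop (𝓝 (2 / (1 - p))) := by
  have h1 : (1 - p) / 2 ≠ 0 := by have := hp.2; intro h; linarith
  have := (tendsto_secondSize_div hp.1 hp.2).inv₀ h1
  simpa only [inv_div] using this

/-- The resampled errors at the two points, centered at their average. -/
noncomputable def centeredErrors (p : ℝ) (E : Fin 2 → ℕ → ℕ → ℝ) (n : ℕ) (j : Fin 2)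
    (i : Fin (secondSize p n)) : ℝ :=
  E j n i - mean fun l : Fin (secondSize p n) => E j n l

/-- The linear part of the bootstrapped root. -/
noncomputable def linearRoot (p b : ℝ) (E : Fin 2 → ℕ → ℕ → ℝ) (n : ℕ)
    (r : Resample (secondSize p n)) : ℝ :=
  -√n / (2 * b * secondSize p n) * ∑ j, ∑ i, centeredErrors p E n j (r (j, i))

/-- The value of f at the sampling point cancels, so resampling shifts the mean only by the average
of the redrawn centred errors. -/
theorem mean_response_resample {k : ℕ} (hk : 0 < k) (c : ℝ) (y : Fin k → ℝ) (π : Fin k → Fin k) :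
    mean (fun i => c + y (π i)) = mean (fun i => c + y i) + (∑ i, (y (π i) - mean y)) / k := by
  have hk' : (k : ℝ) ≠ 0 := by positivity
  rw [mean_const_add hk c y, mean_const_add hk c fun i => y (π i), Finset.sum_sub_distrib, sub_div]
  simp only [Finset.sum_const, Finset.card_univ, Fintype.card_fin, nsmul_eq_mul]
  rw [mul_div_cancel_left₀ _ hk', mean, mean]
  ring

/-- Outside of an event of small conditional probability, the bootstrapped root is close to its
linear part. -/
theorem eventually_bootstrapRoot_close (hp : p ∈ Ioo (0 : ℝ) 1) (hK : 0 < K)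
    (hγ : γ ∈ Ioo (0 : ℝ) (1 / 3)) (hb : 0 < b) (hf : HasDerivAt f b d₀)
    (hd : Tendsto (fun n : ℕ => (n : ℝ) ^ γ * (firstEstimate f d₀ p x n (e n) - d₀)) atTop (𝓝 0))
    (hmean : ∀ j, Tendsto (fun n : ℕ => (n : ℝ) ^ γ *
      mean fun i : Fin (secondSize p n) => E j n i) atTop (𝓝 0))
    (hvar : ∀ j, Tendsto (fun n : ℕ => mean fun i => centeredErrors p E n j i ^ 2) atTop
      (𝓝 (σ ^ 2))) {η : ℝ} (hη : 0 < η) :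
    ∀ᶠ n in atTop, (bootstrapMeasure (secondSize p n)).real
      {r | η < |bootstrapRoot f d₀ p K γ x n (e n) (E 0 n) (E 1 n) r - linearRoot p b E n r|}
        ≤ η := by
  set δ : ℕ → ℝ := fun n => K * (firstSize p n : ℝ) ^ (-γ) with hδ
  set dh : ℕ → ℝ := fun n => firstEstimate f d₀ p x n (e n) with hdh
  set m₀ : ℕ → ℝ := fun n => mean fun i : Fin (secondSize p n) => E 0 n i with hm₀
  set m₁ : ℕ → ℝ := fun n => mean fun i : Fin (secondSize p n) => E 1 n i with hm₁
  set β : ℕ → ℝ := fun n => (f (dh n + δ n) + m₁ n - (f (dh n - δ n) + m₀ n)) / (2 * δ n) with hβ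
  set W : ℕ → ℝ := fun n => f d₀ - (f (dh n - δ n) + m₀ n + (f (dh n + δ n) + m₁ n)) / 2 with hW
  have hδpos : ∀ᶠ n in atTop, 0 < δ n :=
    (eventually_le_rpow_mul_halfWidth hp hK hγ.1).mono fun n hn => hn.1
  have hδne : ∀ᶠ n in atTop, δ n ≠ 0 := hδpos.mono fun n hn => hn.ne'
  have hδ0 : Tendsto δ atTop (𝓝 0) := tendsto_halfWidth hp hγ.1
  have hdδ : Tendsto (fun n => (dh n - d₀) / δ n) atTop (𝓝 0) :=
    tendsto_div_halfWidth hp hK hγ.1 hd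
  have hm₀δ : Tendsto (fun n => m₀ n / δ n) atTop (𝓝 0) :=
    tendsto_div_halfWidth hp hK hγ.1 (hmean 0)
  have hm₁δ : Tendsto (fun n => m₁ n / δ n) atTop (𝓝 0) :=
    tendsto_div_halfWidth hp hK hγ.1 (hmean 1)
  have hL : Tendsto (fun n => (f (dh n - δ n) - f d₀) / δ n) atTop (𝓝 (b * -1)) := by
    refine tendsto_sub_div_of_hasDerivAt hf hδ0 hδne ?_
    have := hdδ.sub_const 1
    rw [zero_sub] at this
    refine this.congr' ?_
    filter_upwards [hδne] with n hn
    field_simp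
    ring
  have hU : Tendsto (fun n => (f (dh n + δ n) - f d₀) / δ n) atTop (𝓝 (b * 1)) := by
    refine tendsto_sub_div_of_hasDerivAt hf hδ0 hδne ?_
    have := hdδ.add_const 1
    rw [zero_add] at this
    refine this.congr' ?_
    filter_upwards [hδne] with n hn
    field_simp
    ring
  have hβb : Tendsto β atTop (𝓝 b) := by
    have h1 := (((hU.sub hL).add hm₁δ).sub hm₀δ).div_const 2
    have h2 : (b * 1 - b * -1 + 0 - 0) / 2 = b := by ring
    rw [h2] at h1
    refine h1.congr' ?_
    filter_upwards [hδne] with n hn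
    simp only [hβ]
    field_simp
    ring
  -- The first-order terms ∓bδ at L and U cancel in the sum, thanks to the symmetry of the two
  -- points.
  have hW0 : Tendsto (fun n => |W n| / δ n) atTop (𝓝 0) := by
    have h1 := ((((hU.add hL).add hm₁δ).add hm₀δ).div_const 2).abs
    have h2 : |(b * 1 + b * -1 + 0 + 0) / 2| = 0 := by simp
    rw [h2] at h1
    refine h1.congr' ?_
    filter_upwards [hδpos] with n hn
    rw [← abs_of_pos hn, ← abs_div, abs_of_pos hn, ← abs_neg]
    congr 1
    simp only [hW]
    field_simp
    ring
  have hsδ : Tendsto (fun n : ℕ => √n * δ n) atTop atTop := tendsto_sqrt_mul_halfWidth hp hK hγ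
  set Q : ℝ := 2 / (1 - p) * σ ^ 2 with hQ
  have hQ0 : 0 ≤ Q := by
    have : 0 < 1 - p := by linarith [hp.2]
    positivity
  have hQn : ∀ j, ∀ᶠ n : ℕ in atTop,
      n / secondSize p n * mean (fun i => centeredErrors p E n j i ^ 2) < Q + 1 := fun j =>
    ((tendsto_div_secondSize hp).mul (hvar j)).eventually_lt_const (by linarith)
  -- `Q` is the limiting variance of √n times each shift, so Chebyshev's inequality bounds the
  -- probability that a shift reaches M/√n by (Q + 1)/M². `M` makes the sum over both points at most
  -- η.
  obtain ⟨M, hM, hMη⟩ : ∃ M : ℝ, 0 < M ∧ 2 * ((Q + 1) / M ^ 2) ≤ η := by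
    refine ⟨√(2 * (Q + 1) / η), by positivity, ?_⟩
    rw [Real.sq_sqrt (by positivity)]
    have : Q + 1 ≠ 0 := by positivity
    apply le_of_eq
    field_simp
  have hMδ : Tendsto (fun n : ℕ => M / (√n * δ n)) atTop (𝓝 0) := hsδ.const_div_atTop M
  have hβb' : Tendsto (fun n => |β n - b|) atTop (𝓝 0) := by
    simpa using (hβb.sub_const b).abs
  have hρ : Tendsto (fun n : ℕ => 4 / b ^ 2 * (|W n| / δ n * M + M * (M / (√n * δ n) + |β n - b|)))
      atTop (𝓝 0) := by
    have := ((hW0.mul_const M).add ((hMδ.add hβb').const_mul M)).const_mul (4 / b ^ 2)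
    simpa using this
  filter_upwards [hδpos, hQn 0, hQn 1, hρ.eventually_lt_const hη,
    hMδ.eventually_lt_const (show 0 < b / 4 by positivity),
    hβb'.eventually_lt_const (show 0 < b / 4 by positivity),
    (tendsto_secondSize hp).eventually_gt_atTop 0, eventually_gt_atTop 0]
    with n hδn hQ₀ hQ₁ hρn hMn hβn hk hn
  have hn0 : (0 : ℝ) < n := by exact_mod_cast hn
  have hk0 : (0 : ℝ) < secondSize p n := by exact_mod_cast hk
  have hs : 0 < √(n : ℝ) := Real.sqrt_pos.2 hn0
  set S : Fin 2 → Resample (secondSize p n) → ℝ := fun j r =>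
    ∑ i, centeredErrors p E n j (r (j, i)) with hS
  -- Threshold for the sum of k errors that corresponds to M/√n for its average.
  set τ : ℝ := M * secondSize p n / √n with hτ
  have hτ0 : 0 < τ := by positivity
  have hcheb : ∀ j, n / secondSize p n * mean (fun i => centeredErrors p E n j i ^ 2) < Q + 1 →
      (bootstrapMeasure (secondSize p n)).real {r | τ ≤ |S j r|} ≤ (Q + 1) / M ^ 2 := by
    intro j hj
    refine (bootstrapMeasure_real_abs_sum_ge_le hk (centeredErrors p E n j)
      (sum_sub_mean _) j hτ0).trans ?_
    have e1 : secondSize p n * mean (fun i => centeredErrors p E n j i ^ 2) / τ ^ 2 =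
        (n / secondSize p n * mean (fun i => centeredErrors p E n j i ^ 2)) / M ^ 2 := by
      rw [hτ, div_pow, mul_pow, Real.sq_sqrt hn0.le]
      field_simp
    rw [e1]
    gcongr
  have hsub : {r | η < |bootstrapRoot f d₀ p K γ x n (e n) (E 0 n) (E 1 n) r -
      linearRoot p b E n r|} ⊆ {r | τ ≤ |S 0 r|} ∪ {r | τ ≤ |S 1 r|} := by
    intro r hr
    by_contra hcon
    simp only [mem_union, mem_ofPred_eq, not_or, not_le] at hcon hr
    have hbd : ∀ j, |S j r| < τ → √n * |S j r / secondSize p n| ≤ M := by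
      intro j hj
      rw [abs_div, abs_of_pos hk0, ← mul_div_assoc, div_le_iff₀ hk0]
      have := mul_le_mul_of_nonneg_left hj.le hs.le
      rwa [hτ, mul_div_cancel₀ _ hs.ne'] at this
    have hmy : mean (lowerResponse f d₀ p K γ x n (e n) (E 0 n)) = f (dh n - δ n) + m₀ n :=
      mean_const_add hk _ _
    have hmz : mean (upperResponse f d₀ p K γ x n (e n) (E 1 n)) = f (dh n + δ n) + m₁ n :=
      mean_const_add hk _ _
    have hmy' : mean (fun i => lowerResponse f d₀ p K γ x n (e n) (E 0 n) (r (0, i))) =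
        f (dh n - δ n) + m₀ n + S 0 r / secondSize p n := by
      rw [← hmy]
      exact mean_response_resample hk _ (fun i => E 0 n i) fun i => r (0, i)
    have hmz' : mean (fun i => upperResponse f d₀ p K γ x n (e n) (E 1 n) (r (1, i))) =
        f (dh n + δ n) + m₁ n + S 1 r / secondSize p n := by
      rw [← hmz]
      exact mean_response_resample hk _ (fun i => E 1 n i) fun i => r (1, i)
    have hUL : upperPoint f d₀ p K γ x n (e n) - lowerPoint f d₀ p K γ x n (e n) = 2 * δ n := by
      simp only [upperPoint, lowerPoint, hδ]; ring
    obtain ⟨hβ0, hβ'0, hlin⟩ := abs_root_sub_linear_le (W := W n) (β := β n) (s := √n) (δ := δ n)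
      (A := S 0 r / secondSize p n) (B := S 1 r / secondSize p n) hb hδn hs hβn.le rfl
      (hbd 0 hcon.1) (hbd 1 hcon.2) hMn.le
    have hsl : lsSlope (lowerPoint f d₀ p K γ x n (e n)) (upperPoint f d₀ p K γ x n (e n))
        (lowerResponse f d₀ p K γ x n (e n) (E 0 n))
        (upperResponse f d₀ p K γ x n (e n) (E 1 n)) = β n := by
      rw [lsSlope, hmy, hmz, hUL]
    have hsl' : lsSlope (lowerPoint f d₀ p K γ x n (e n)) (upperPoint f d₀ p K γ x n (e n))
        (fun i => lowerResponse f d₀ p K γ x n (e n) (E 0 n) (r (0, i)))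
        (fun i => upperResponse f d₀ p K γ x n (e n) (E 1 n) (r (1, i))) =
        β n + (S 1 r / secondSize p n - S 0 r / secondSize p n) / (2 * δ n) := by
      rw [lsSlope, hmy', hmz', hUL]
      simp only [hβ]
      ring
    have hroot : bootstrapRoot f d₀ p K γ x n (e n) (E 0 n) (E 1 n) r =
        √n * ((W n - (S 0 r / secondSize p n + S 1 r / secondSize p n) / 2) /
          (β n + (S 1 r / secondSize p n - S 0 r / secondSize p n) / (2 * δ n)) - W n / β n) := by
      rw [bootstrapRoot, bootstrapEstimate, twoStageEstimate, lsInverse_eq (by rwa [hsl']),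
        lsInverse_eq (by rwa [hsl]), hsl, hsl', hmy, hmz, hmy', hmz']
      simp only [hW]
      ring
    have hT : linearRoot p b E n r =
        -√n * (S 0 r / secondSize p n + S 1 r / secondSize p n) / (2 * b) := by
      rw [linearRoot, Fin.sum_univ_two]
      simp only [hS]
      field_simp
    rw [hroot, hT] at hr
    linarith
  calc _ ≤ (bootstrapMeasure (secondSize p n)).real ({r | τ ≤ |S 0 r|} ∪ {r | τ ≤ |S 1 r|}) :=
        measureReal_mono hsub (measure_ne_top _ _)
    _ ≤ _ := measureReal_union_le _ _
    _ ≤ (Q + 1) / M ^ 2 + (Q + 1) / M ^ 2 := add_le_add (hcheb 0 hQ₀) (hcheb 1 hQ₁)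
    _ ≤ η := by linarith

/-- Consistency of the bootstrap for given data. -/
theorem tendstoInDistribution_bootstrapRoot (hp : p ∈ Ioo (0 : ℝ) 1) (hK : 0 < K)
    (hγ : γ ∈ Ioo (0 : ℝ) (1 / 3)) (hb : 0 < deriv f d₀) (hf : DifferentiableAt ℝ f d₀)
    (hd : Tendsto (fun n : ℕ => (n : ℝ) ^ γ * (firstEstimate f d₀ p x n (e n) - d₀)) atTop (𝓝 0))
    (hmean : ∀ j, Tendsto (fun n : ℕ => (n : ℝ) ^ γ *
      mean fun i : Fin (secondSize p n) => E j n i) atTop (𝓝 0))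
    (hsq : ∀ j, Tendsto (fun n : ℕ => mean fun i : Fin (secondSize p n) => E j n i ^ 2) atTop
      (𝓝 (σ ^ 2)))
    (hcube : ∀ j, Tendsto (fun n : ℕ => mean fun i : Fin (secondSize p n) => |E j n i| ^ 3) atTop
      (𝓝 κ)) :
    TendstoInDistribution (fun n => bootstrapRoot f d₀ p K γ x n (e n) (E 0 n) (E 1 n)) atTop
      (fun z : ℝ => limitScale f d₀ p σ * z) (fun n => bootstrapMeasure (secondSize p n))
      (gaussianReal 0 1) := by
  set b := deriv f d₀ with hbdef
  have hp1 : 0 < 1 - p := by linarith [hp.2]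
  have hk := tendsto_secondSize hp
  have hmean0 : ∀ j, Tendsto (fun n : ℕ => mean fun i : Fin (secondSize p n) => E j n i) atTop
      (𝓝 0) := by
    intro j
    have h0 := (hmean j).abs
    rw [abs_zero] at h0
    refine squeeze_zero_norm' ?_ h0
    filter_upwards [eventually_ge_atTop 1] with n hn
    have h1 : (1 : ℝ) ≤ (n : ℝ) ^ γ := Real.one_le_rpow (by exact_mod_cast hn) hγ.1.le
    rw [Real.norm_eq_abs, abs_mul, abs_of_nonneg (zero_le_one.trans h1)]
    exact le_mul_of_one_le_left (abs_nonneg _) h1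
  have hvar : ∀ j, Tendsto (fun n : ℕ => mean fun i => centeredErrors p E n j i ^ 2) atTop
      (𝓝 (σ ^ 2)) := by
    intro j
    have h1 := (hsq j).sub ((hmean0 j).pow 2)
    rw [zero_pow two_ne_zero, sub_zero] at h1
    refine h1.congr' ?_
    filter_upwards [hk.eventually_gt_atTop 0] with n hn
    exact (mean_sub_mean_sq hn _).symm
  have hcube' : ∀ j, ∀ᶠ n in atTop,
      mean (fun i => |centeredErrors p E n j i| ^ 3) ≤ 4 * κ + 1 := by
    intro j
    have h1 := ((((hmean0 j).abs).pow 3).add (hcube j)).const_mul 4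
    rw [abs_zero, zero_pow three_ne_zero, zero_add] at h1
    filter_upwards [h1.eventually_lt_const (lt_add_one _), hk.eventually_gt_atTop 0] with n h2 h3
    exact (mean_abs_sub_mean_cube_le h3 _).trans h2.le
  have hdiv := tendsto_div_secondSize hp
  refine ⟨fun n => (measurable_of_finite _).aemeasurable, by fun_prop, ?_⟩
  refine ProbabilityMeasure.tendsto_iff_tendsto_charFun.2 fun s => ?_
  set c : ℕ → ℝ := fun n => -√n / (2 * b * secondSize p n) with hc
  -- k(s c)² = s² n/(4b²k), where n/k → 2/(1 - p). Multiplied by σ², the limit is half of s² times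
  -- the squared limit scale, the Gaussian exponent.
  have hkc : Tendsto (fun n => secondSize p n * (s * c n) ^ 2) atTop
      (𝓝 (s ^ 2 / (4 * b ^ 2) * (2 / (1 - p)))) := by
    refine (hdiv.const_mul (s ^ 2 / (4 * b ^ 2))).congr' ?_
    filter_upwards [hk.eventually_gt_atTop 0] with n hn
    have hk0 : (0 : ℝ) < secondSize p n := by exact_mod_cast hn
    simp only [hc]
    rw [mul_pow, div_pow, neg_sq, Real.sq_sqrt (Nat.cast_nonneg n)]
    field_simp
    ring
  have hc0 : Tendsto (fun n => s * c n) atTop (𝓝 0) := by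
    have h1 : Tendsto (fun n => (secondSize p n * (s * c n) ^ 2) * (secondSize p n : ℝ)⁻¹) atTop
        (𝓝 0) := by
      have := hkc.mul ((tendsto_natCast_atTop_atTop (R := ℝ)).comp hk).inv_tendsto_atTop
      simpa using this
    have h2 : Tendsto (fun n => (s * c n) ^ 2) atTop (𝓝 0) := by
      refine h1.congr' ?_
      filter_upwards [hk.eventually_gt_atTop 0] with n hn
      have hk0 : (0 : ℝ) < secondSize p n := by exact_mod_cast hn
      field_simp
    have h3 := (Real.continuous_sqrt.tendsto 0).comp h2
    rw [Real.sqrt_zero] at h3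
    rw [tendsto_zero_iff_abs_tendsto_zero]
    refine h3.congr fun n => ?_
    simp [Real.sqrt_sq_eq_abs]
  have hclt := tendsto_integral_exp_bootstrap hk (w := centeredErrors p E)
    (fun n j => sum_sub_mean _) hc0 hkc hvar hcube'
  have hclt' : Tendsto (fun n => ∫ r, Complex.exp (((s * linearRoot p b E n r : ℝ) : ℂ) *
      Complex.I) ∂(bootstrapMeasure (secondSize p n))) atTop
      (𝓝 (Complex.exp ((-(s ^ 2 / (4 * b ^ 2) * (2 / (1 - p)) * σ ^ 2) : ℝ) : ℂ))) := by
    refine hclt.congr fun n => ?_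
    simp only [linearRoot, hc, mul_assoc]
  have hfin := tendsto_integral_exp_of_close
    (X := fun n => bootstrapRoot f d₀ p K γ x n (e n) (E 0 n) (E 1 n))
    (fun n => measurable_of_finite _) (fun n => measurable_of_finite (linearRoot p b E n))
    (fun η hη => eventually_bootstrapRoot_close hp hK hγ hb hf.hasDerivAt hd hmean hvar hη) hclt'
  have hlim : charFun ((gaussianReal 0 1).map fun z : ℝ => limitScale f d₀ p σ * z) s =
      Complex.exp ((-(s ^ 2 / (4 * b ^ 2) * (2 / (1 - p)) * σ ^ 2) : ℝ) : ℂ) := by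
    have h1 := gaussianReal_map_const_mul (μ := 0) (v := 1) (limitScale f d₀ p σ)
    rw [h1, charFun_gaussianReal]
    have h2 : limitScale f d₀ p σ ^ 2 = σ ^ 2 / (b ^ 2 * (1 - p)) := by
      rw [limitScale, div_pow, mul_pow, Real.sq_sqrt hp1.le]
    have h3 : -(s ^ 2 / (4 * b ^ 2) * (2 / (1 - p)) * σ ^ 2) =
        -(limitScale f d₀ p σ ^ 2 * s ^ 2 / 2) := by
      rw [h2]
      field_simp
      ring
    rw [h3]
    congr 1
    push_cast
    simp
  have hgoal : ∀ n, charFun ((bootstrapMeasure (secondSize p n)).map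
      (bootstrapRoot f d₀ p K γ x n (e n) (E 0 n) (E 1 n))) s =
      ∫ r, Complex.exp (((s * bootstrapRoot f d₀ p K γ x n (e n) (E 0 n) (E 1 n) r : ℝ) : ℂ) *
        Complex.I) ∂(bootstrapMeasure (secondSize p n)) := by
    intro n
    rw [charFun_apply_real, integral_map (measurable_of_finite _).aemeasurable
      (by fun_prop)]
    push_cast
    rfl
  simp only [ProbabilityMeasure.coe_mk, hlim, hgoal]
  exact hfin

end GivenData

/-! ### Laws of large numbers for the errors, and conclusion -/

theorem integrable_abs_sub_const_pow {μ : Measure ℝ} [IsFiniteMeasure μ] {h : ℝ → ℝ}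
    (hm : Measurable h) (hint : ∀ r : ℕ, Integrable (fun z => |h z| ^ r) μ) (c : ℝ) (r : ℕ) :
    Integrable (fun z => |h z - c| ^ r) μ := by
  refine (((hint r).add (integrable_const (|c| ^ r))).const_mul (2 ^ (r - 1))).mono'
    (by fun_prop) (ae_of_all _ fun z => ?_)
  rw [Real.norm_of_nonneg (by positivity)]
  exact (pow_le_pow_left₀ (abs_nonneg _) (abs_sub _ _) r).trans
    (add_pow_le (abs_nonneg _) (abs_nonneg _) r)

/-- Law of large numbers along the second-stage errors. -/
theorem IsErrorArray.ae_tendsto_mean_comp {Ω : Type*} [MeasurableSpace Ω] {P : Measure Ω}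
    [IsProbabilityMeasure P] {μ : Measure ℝ} [IsProbabilityMeasure μ]
    {ε ε' ε'' : ℕ → ℕ → Ω → ℝ} (hε : IsErrorArray P μ ε ε' ε'') (j : Fin 3) {p : ℝ}
    (hp : p ∈ Ioo (0 : ℝ) 1) {h : ℝ → ℝ} (hm : Measurable h)
    (hint : ∀ r : ℕ, Integrable (fun z => |h z| ^ r) μ) :
    ∀ᵐ ω ∂P, Tendsto (fun n : ℕ =>
      mean fun i : Fin (secondSize p n) => h ((![ε n, ε' n, ε'' n] j : ℕ → Ω → ℝ) i ω))
      atTop (𝓝 (∫ z, h z ∂μ)) := by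
  set c := ∫ z, h z ∂μ with hc
  have hi : Integrable h μ := by
    have h1 := hint 1
    simp only [pow_one] at h1
    exact (integrable_norm_iff hm.aestronglyMeasurable).1 h1
  filter_upwards [hε.ae_tendsto_mean j hp (φ := fun z => h z - c) (by fun_prop)
    (integrable_abs_sub_const_pow hm hint c)
    (by rw [integral_sub hi (integrable_const _)]; simp [hc]) (a := 0) (by norm_num)] with ω hω
  have h1 := hω.const_add c
  rw [add_zero] at h1
  refine h1.congr' ?_
  filter_upwards [(tendsto_secondSize hp).eventually_gt_atTop 0] with n hn
  rw [Real.rpow_zero, one_mul, ← mean_const_add hn]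
  simp

end TwoStage

theorem theorem3
    {Ω : Type*} [MeasurableSpace Ω] (P : Measure Ω) [IsProbabilityMeasure P]
    (f : ℝ → ℝ) (d₀ p K γ σ : ℝ) (x : (m : ℕ) → Fin m → ℝ)
    (μ : Measure ℝ) (ε ε' ε'' : ℕ → ℕ → Ω → ℝ)
    (hd₀ : d₀ ∈ Ioo (0 : ℝ) 1) (hp : p ∈ Ioo (0 : ℝ) 1) (hK : 0 < K)
    (hγ : γ ∈ Ioo (0 : ℝ) (1 / 3))
    (hμ : TwoStage.IsErrorLaw μ σ) (hε : TwoStage.IsErrorArray P μ ε ε' ε'')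
    (hf : TwoStage.InClassF f d₀)
    (hx : TwoStage.IsDesignArray x) (hxG : TwoStage.IsRegularDesign x)
    (hf' : TwoStage.HasBoundedSlope f)
    (hmom : TwoStage.HasAllMoments μ) :
    ∀ᵐ ω ∂P,
      TendstoInDistribution
        (fun n => TwoStage.bootstrapRoot f d₀ p K γ x n
          (fun i => ε n i ω) (fun i => ε' n i ω) (fun i => ε'' n i ω))
        atTop
        (fun z : ℝ => TwoStage.limitScale f d₀ p σ * z)
        (fun n => TwoStage.bootstrapMeasure (TwoStage.secondSize p n))
        (gaussianReal 0 1) ∧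
      Tendsto
        (fun n : ℕ => ⨆ t : ℝ,
          |(TwoStage.bootstrapMeasure (TwoStage.secondSize p n)).real
              {r | TwoStage.bootstrapRoot f d₀ p K γ x n
                (fun i => ε n i ω) (fun i => ε' n i ω) (fun i => ε'' n i ω) r ≤ t}
            - (gaussianReal 0 1).real {z : ℝ | TwoStage.limitScale f d₀ p σ * z ≤ t}|)
        atTop (𝓝 0) := by
  have hprob := hμ.isProbabilityMeasure
  obtain ⟨δ, hδ, hdiff, -⟩ := hf.smooth_near
  obtain ⟨hfd, hb⟩ := hdiff d₀ ⟨by linarith, by linarith⟩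
  have hscale : TwoStage.limitScale f d₀ p σ ≠ 0 := by
    have h1 : 0 < 1 - p := by linarith [hp.2]
    have h2 := hμ.pos
    unfold TwoStage.limitScale
    positivity
  have hmean : ∀ j : Fin 3, _ := fun j => hε.ae_tendsto_mean j hp measurable_id hmom
    hμ.mean_eq (a := γ) (by linarith [hγ.2])
  have hsq : ∀ j : Fin 3, _ := fun j => hε.ae_tendsto_mean_comp j hp (h := fun z => z ^ 2)
    (by fun_prop) fun r => by simpa only [abs_pow, ← pow_mul] using hmom (2 * r)
  have hcube : ∀ j : Fin 3, _ := fun j => hε.ae_tendsto_mean_comp j hp (h := fun z => |z| ^ 3)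
    (by fun_prop) fun r => by simpa only [abs_pow, abs_abs, ← pow_mul] using hmom (3 * r)
  rw [hμ.var_eq] at hsq
  filter_upwards [TwoStage.ae_tendsto_firstEstimate hε hmom hμ.mean_eq hf' hd₀ hp hγ hx hxG,
    ae_all_iff.2 hmean, ae_all_iff.2 hsq, ae_all_iff.2 hcube] with ω h1 h2 h3 h4
  -- For fixed data only the errors at L and U are resampled; they are numbers 1 and 2 of the three
  -- error sequences.
  have hdist := TwoStage.tendstoInDistribution_bootstrapRoot (K := K) (x := x)
    (e := fun n i => ε n i ω) (E := ![fun n i => ε' n i ω, fun n i => ε'' n i ω])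
    hp hK hγ hb hfd h1
    (fun j => by
      fin_cases j
      · exact h2 1
      · exact h2 2)
    (fun j => by
      fin_cases j
      · exact h3 1
      · exact h3 2)
    (fun j => by
      fin_cases j
      · exact h4 1
      · exact h4 2)
  refine ⟨hdist, TwoStage.tendsto_iSup_abs_sub_of_tendstoInDistribution hdist fun t => ?_⟩
  have := nullSingletonClass_gaussianReal (μ := 0) (v := 1) one_ne_zero
  rw [Measure.map_apply (by fun_prop) (measurableSet_singleton t)]
  -- The limit law has no atoms: as the scale is nonzero, the preimage of a point is a point.
  refine measure_mono_null (fun z hz => ?_)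
    (measure_singleton (μ := gaussianReal 0 1) (t / TwoStage.limitScale f d₀ p σ))
  rw [mem_singleton_iff, eq_div_iff hscale, mul_comm]
  exact hz
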